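/- Let $R$ be a commutative ring and let $\mathfrak G$ be an affine group scheme over $R$, i.e. a functor from commutative $R$-algebras to groups which is represented by a commutative $R$-algebra $H=R(\mathfrak G)$; by the Yoneda lemma $H$ is a commutative Hopf algebra, with comultiplication $\Delta(c)=\sum c_1\otimes c_2$ and counit $\varepsilon$. Let $H^*=\mathrm{Hom}_R(H,R)$ carry the convolution product $(f\star g)(c)=\sum f(c_1)g(c_2)$ and the finite topology (induced by $H^*\subset R^H$, $R$ discrete). Put $\omega=\ker\varepsilon$ and let $hy(\mathfrak G)=\{f\in H^*: f(\omega^n)=0 \text{ for some } n\ge 1\}$, a subalgebra of $H^*$. For $B=H^*$ or $B=hy(\mathfrak G)$, $H$ is a left $B$-module by $f\rightharpoonup c=\sum c_1f(c_2)$; $\sigma[{}_BH]$ is the full subcategory of left $B$-modules isomorphic to a submodule of a quotient of a direct sum of copies of $H$, and $\mathrm{Rat}^{H}({}_B\mathcal M)$ is the full subcategory of left $B$-modules $M$ such that for each $m\in M$ there is $\sum m_i\otimes c_i\in M\otimes_RH$ with $fm=\sum f(c_i)m_i$ for all $f\in B$. ${}_{\mathfrak G}\mathcal M$ is the category of left $\mathfrak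 G$-modules ($R$-modules $M$ with $A$-linear actions of $\mathfrak G(A)$ on $M\otimes_RA$, functorial in the commutative $R$-algebra $A$), and $\mathcal M^{H}$ is the category of counital right $H$-comodules. Call $\mathfrak G$ *locally projective* if $H$ is a locally projective $R$-module (every $R$-linear map $H\to N$ can be lifted along every surjection $L\to N$ on any given finitely generated submodule of $H$, by a linear map $H\to L$); *connected* if $hy(\mathfrak G)$ is dense in $H^*$; and say that $\mathfrak G$ *satisfies the $\alpha$-condition* if for every $R$-module $M$ the map $M\otimes_RH\to\mathrm{Hom}_R(hy(\mathfrak G),M)$, $m\otimes c\mapsto[f\mapsto f(c)m]$, is injective. 1. If $\mathfrak G$ is locally projective, then the canonical functor $\mathcal M^{H}\to{}_{\mathfrak G}\mathcal M$ is an equivalence of categories, the canonical functor $\mathcal M^{H}\to\mathrm{Rat}^{H}({}_{H^*}\mathcal M)$, $fm=\sum m_0f(m_1)$, is an isomorphism of categories, and $\mathrm{Rat}^{H}({}_{H^*}\mathcal M)=\sigma[{}_{H^*}H]$. 2. $\mathfrak G$ satisfies the $\alpha$-condition if and only if $\mathfrak G$ is locally projective and connected. In this case, in addition to the assertions in 1,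 restriction of scalars $\mathrm{Rat}^{H}({}_{H^*}\mathcal M)\to\mathrm{Rat}^{H}({}_{hy(\mathfrak G)}\mathcal M)$ is an isomorphism of categories, and $\mathrm{Rat}^{H}({}_{hy(\mathfrak G)}\mathcal M)=\sigma[{}_{hy(\mathfrak G)}H]$. 3. $\mathfrak G$ is connected if and only if $\sigma[{}_{hy(\mathfrak G)}H]=\sigma[{}_{H^*}H]$, in the sense that restriction of scalars $\sigma[{}_{H^*}H]\to\sigma[{}_{hy(\mathfrak G)}H]$ is an isomorphism of categories (bijective on objects and on morphisms). If $R$ is an injective cogenerator in the category of $R$-modules, then $\mathfrak G$ is connected if and only if the canonical map $H\to hy(\mathfrak G)^*$ is injective, and if and only if the $\omega$-adic topology on $H$ is Hausdorff. -/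

import Mathlib

open CategoryTheory TensorProduct

universe u

noncomputable section

/-! ## Isomorphisms of categories -/

/-- A functor is an isomorphism of categories iff it is bijective on morphisms and on objects. -/
def IsIsoOfCategories {C D : Type*} [Category* C] [Category* D] (F : C ⥤ D) : Prop :=
  F.Full ∧ F.Faithful ∧ Function.Bijective F.obj

/-! ## Pairings, the `α`-condition, local projectivity -/

section Pairings

variable {R : Type u} [CommRing R]

/-- For a pairing `κ : V → W^*` and an `R`-module `M`, the map
`M ⊗ W → Hom_R(V, M)`, `m ⊗ w ↦ (v ↦ ⟨v, w⟩ m)`. -/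
def alphaMap {V W : Type u} [AddCommGroup V] [Module R V] [AddCommGroup W] [Module R W]
    (κ : V →ₗ[R] W →ₗ[R] R) (M : Type u) [AddCommGroup M] [Module R M] :
    M ⊗[R] W →ₗ[R] (V →ₗ[R] M) :=
  TensorProduct.lift <| LinearMap.mk₂ R (fun m w => (κ.flip w).smulRight m)
    (fun m m' w => by ext v; simp)
    (fun c m w => by ext v; exact smul_comm _ _ _)
    (fun m w w' => by ext v; simp [add_smul])
    (fun c m w => by
      ext v
      change κ v (c • w) • m = c • κ v w • m
      rw [map_smul, smul_assoc])

@[simp] lemma alphaMap_tmul {V W : Type u} [AddCommGroup V] [Module R V] [AddCommGroup W]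
    [Module R W] (κ : V →ₗ[R] W →ₗ[R] R) (M : Type u) [AddCommGroup M] [Module R M]
    (m : M) (w : W) (v : V) : alphaMap κ M (m ⊗ₜ w) v = κ v w • m := by
  simp [alphaMap]

/-- The `α`-condition for an `R`-pairing `(V, W)`. -/
def AlphaCondition {V W : Type u} [AddCommGroup V] [Module R V] [AddCommGroup W] [Module R W]
    (κ : V →ₗ[R] W →ₗ[R] R) : Prop :=
  ∀ (M : Type u) [AddCommGroup M] [Module R M], Function.Injective (alphaMap κ M)

/-- `W` is locally projective (in the sense of Zimmermann-Huisgen): maps out of `W` lift along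
surjections after restriction to any finitely generated submodule of `W`. -/
def IsLocallyProjective (R : Type u) [CommRing R] (W : Type u) [AddCommGroup W] [Module R W] :
    Prop :=
  ∀ (L N : Type u) [AddCommGroup L] [Module R L] [AddCommGroup N] [Module R N]
    (g : L →ₗ[R] N) (_ : Function.Surjective g) (f : W →ₗ[R] N)
    (W₀ : Submodule R W), W₀.FG → ∃ h : W →ₗ[R] L, ∀ w ∈ W₀, g (h w) = f w

end Pairings

/-! ## Subgenerated modules and rational modules -/

/-- Objects of `σ[_A K]`: modules isomorphic to a submodule of a `K`-generated module
(a quotient of a direct sum of copies of `K`). -/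
def IsSubgenerated {A : Type u} [Ring A] (K : ModuleCat.{u} A) :
    ObjectProperty (ModuleCat.{u} A) := fun N =>
  ∃ Q : ModuleCat.{u} A,
    (∃ (Λ : Type u) (g : (Λ →₀ K) →ₗ[A] Q), Function.Surjective g) ∧
    ∃ i : N →ₗ[A] Q, Function.Injective i

/-- For a pairing of an `R`-algebra `A` with an `R`-module `C` and a left `A`-module `M`, the
`R`-submodule `Rat^C(_A M)`: the preimage of `M ⊗ C` (i.e. of the image of
`M ⊗ C → Hom_R(A, M)`) under `M → Hom_R(A, M)`, `m ↦ (a ↦ a m)`. -/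
def rat {R A C : Type u} [CommRing R] [Ring A] [Algebra R A] [AddCommGroup C] [Module R C]
    (κ : A →ₗ[R] C →ₗ[R] R) (M : Type u) [AddCommGroup M] [Module R M] [Module A M]
    [IsScalarTower R A M] : Submodule R M :=
  (LinearMap.range (alphaMap κ M)).comap (Algebra.lsmul R R M : A →ₐ[R] _).toLinearMap.flip

/-- Objects of `Rat^C(_A 𝓜)`: the left `A`-modules `M` (which are `R`-modules through `R → A`)
with `Rat^C(_A M) = M`. -/
def IsRational {R A C : Type u} [CommRing R] [Ring A] [Algebra R A] [AddCommGroup C] [Module R C]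
    (κ : A →ₗ[R] C →ₗ[R] R) : ObjectProperty (ModuleCat.{u} A) := fun M =>
  letI : Module R M := Module.restrictScalars R A M
  haveI : IsScalarTower R A M := IsScalarTower.restrictScalars R A M
  rat κ M = ⊤

/-- The pairing `(B, C)` obtained from a pairing `(A, C)` and a subalgebra `B ⊆ A`. -/
def restrictPairing {R A C : Type u} [CommRing R] [Ring A] [Algebra R A]
    [AddCommGroup C] [Module R C] (κ : A →ₗ[R] C →ₗ[R] R) (B : Subalgebra R A) :
    B →ₗ[R] C →ₗ[R] R :=
  κ ∘ₗ B.val.toLinearMap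

section Restriction

variable {R A C : Type u} [CommRing R] [Ring A] [Algebra R A] [AddCommGroup C] [Module R C]

/-- The left `A`-module `K` as a left module over the subalgebra `B ⊆ A`. -/
def restrictModule (B : Subalgebra R A) (K : ModuleCat.{u} A) : ModuleCat.{u} B :=
  (ModuleCat.restrictScalars B.val.toRingHom).obj K

lemma IsSubgenerated.restrict (B : Subalgebra R A) (K N : ModuleCat.{u} A)
    (h : IsSubgenerated K N) :
    IsSubgenerated (restrictModule B K) ((ModuleCat.restrictScalars B.val.toRingHom).obj N) := by
  obtain ⟨Q, ⟨Λ, g, hg⟩, i, hi⟩ := h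
  refine ⟨restrictModule B Q,
    ⟨Λ, { toFun := g, map_add' := g.map_add, map_smul' := fun b x => ?_ }, hg⟩,
    { toFun := i, map_add' := i.map_add, map_smul' := fun b x => i.map_smul (b : A) x }, hi⟩
  exact g.map_smul (b : A) x

lemma rat_restrict (κ : A →ₗ[R] C →ₗ[R] R) (B : Subalgebra R A)
    (M : Type u) [AddCommGroup M] [Module R M] [Module A M] [IsScalarTower R A M]
    (i : Module B M) (_ : @IsScalarTower R B M _ i.toSMul _)
    (hB : ∀ (b : B) (m : M), i.smul b m = (b : A) • m)
    (h : rat κ M = ⊤) :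
    @rat R B C _ _ _ _ _ (restrictPairing κ B) M _ _ i _ = ⊤ := by
  rw [eq_top_iff]
  rintro m -
  obtain ⟨t, ht⟩ : m ∈ rat κ M := h ▸ Submodule.mem_top
  refine ⟨t, ?_⟩
  ext b
  change _ = i.smul b m
  have h1 : alphaMap κ M t (b : A) = (b : A) • m := DFunLike.congr_fun ht (b : A)
  rw [hB, ← h1]
  clear ht h1
  induction t with
  | zero => simp
  | add s t hs ht => simp only [map_add, LinearMap.add_apply, hs, ht]
  | tmul a b => simp [restrictPairing]

lemma IsRational.restrict (κ : A →ₗ[R] C →ₗ[R] R) (B : Subalgebra R A) (N : ModuleCat.{u} A)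
    (h : IsRational κ N) :
    IsRational (restrictPairing κ B) ((ModuleCat.restrictScalars B.val.toRingHom).obj N) := by
  let i1 : Module R N := Module.restrictScalars R A N
  have i2 : IsScalarTower R A N := IsScalarTower.restrictScalars R A N
  let i3 : Module B N := Module.compHom N B.val.toRingHom
  have key : ∀ (inst : Module R N) (_ : inst = i1)
      (_ : @IsScalarTower R B N _ i3.toSMul inst.toSMul),
      @rat R B C _ _ _ _ _ (restrictPairing κ B) N _ inst i3 _ = ⊤ := by
    rintro _ rfl hs
    exact rat_restrict κ B N i3 hs (fun _ _ => rfl) h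
  exact key _ (Module.ext' _ _ fun r m => rfl) _

/-- Restriction of scalars `Rat^C(_A 𝓜) → Rat^C(_B 𝓜)` for a subalgebra `B ⊆ A`. -/
def ratRestrict (κ : A →ₗ[R] C →ₗ[R] R) (B : Subalgebra R A) :
    (IsRational κ).FullSubcategory ⥤ (IsRational (restrictPairing κ B)).FullSubcategory :=
  ObjectProperty.lift _ (ObjectProperty.ι _ ⋙ ModuleCat.restrictScalars B.val.toRingHom)
    (fun N => IsRational.restrict κ B N.obj N.property)

/-- Restriction of scalars `σ[_A K] → σ[_B K]` for a subalgebra `B ⊆ A`. -/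
def sigmaRestrict (K : ModuleCat.{u} A) (B : Subalgebra R A) :
    (IsSubgenerated K).FullSubcategory ⥤ (IsSubgenerated (restrictModule B K)).FullSubcategory :=
  ObjectProperty.lift _ (ObjectProperty.ι _ ⋙ ModuleCat.restrictScalars B.val.toRingHom)
    (fun N => IsSubgenerated.restrict B K N.obj N.property)

end Restriction

/-! ## Comodules -/

section Comodules

variable (R C : Type u) [CommRing R] [AddCommGroup C] [Module R C] [Coalgebra R C]

/-- The dual algebra `C^*` with the convolution product `(f ⋆ g)(c) = ∑ f(c₁) g(c₂)`. -/
abbrev DualAlg : Type u := WithConv (C →ₗ[R] R)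

/-- Counital right `C`-comodules. -/
structure RightComod where
  /-- the underlying module -/
  carrier : Type u
  [addCommGroup : AddCommGroup carrier]
  [module : Module R carrier]
  /-- the coaction `M → M ⊗ C` -/
  coact : carrier →ₗ[R] carrier ⊗[R] C
  coassoc : (TensorProduct.assoc R carrier C C).toLinearMap ∘ₗ coact.rTensor C ∘ₗ coact =
    (Coalgebra.comul (R := R) (A := C)).lTensor carrier ∘ₗ coact
  counital : (TensorProduct.rid R carrier).toLinearMap ∘ₗ
    (Coalgebra.counit (R := R) (A := C)).lTensor carrier ∘ₗ coact = LinearMap.id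

variable {R C}

namespace RightComod

instance : CoeSort (RightComod R C) (Type u) := ⟨carrier⟩

attribute [instance] addCommGroup module

/-- Colinear maps. -/
@[ext] structure Hom (M N : RightComod R C) where
  /-- the underlying linear map -/
  toLinearMap : M →ₗ[R] N
  comm : N.coact ∘ₗ toLinearMap = toLinearMap.rTensor C ∘ₗ M.coact

/-- The category `𝓜^C` of right `C`-comodules. -/
instance : Category (RightComod R C) where
  Hom := Hom
  id M := ⟨LinearMap.id, by simp⟩
  comp f g := ⟨g.toLinearMap ∘ₗ f.toLinearMap, by
    rw [← LinearMap.comp_assoc, g.comm, LinearMap.comp_assoc, f.comm, LinearMap.rTensor_comp,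
      LinearMap.comp_assoc]⟩

variable (R C) in
/-- `C` as a right `C`-comodule. -/
def regular : RightComod R C where
  carrier := C
  coact := Coalgebra.comul
  coassoc := Coalgebra.coassoc
  counital := by
    rw [Coalgebra.lTensor_counit_comp_comul]; ext; simp

/-- The action of `f ∈ C^*` on a right `C`-comodule: `f m = ∑ m₀ f(m₁)`. -/
def dualAct (M : RightComod R C) (f : C →ₗ[R] R) : M →ₗ[R] M :=
  (TensorProduct.rid R M).toLinearMap ∘ₗ f.lTensor M ∘ₗ M.coact

lemma dualAct_counit (M : RightComod R C) (m : M) : M.dualAct Coalgebra.counit m = m :=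
  DFunLike.congr_fun M.counital m

lemma dualAct_mul (M : RightComod R C) (f g : DualAlg R C) (m : M) :
    M.dualAct (f * g).ofConv m = M.dualAct f.ofConv (M.dualAct g.ofConv m) := by
  have h1 : ∀ (s : M ⊗[R] C) (c : C),
      TensorProduct.rid R M ((LinearMap.mul' R R ∘ₗ
        TensorProduct.map f.ofConv g.ofConv).lTensor M (TensorProduct.assoc R M C C (s ⊗ₜ c))) =
      g.ofConv c • TensorProduct.rid R M (f.ofConv.lTensor M s) := by
    intro s c
    induction s with
    | zero => simp
    | add s t hs ht => rw [TensorProduct.add_tmul]; simp only [map_add, hs, ht, smul_add]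
    | tmul a b => simp [smul_smul, mul_comm]
  have h2 : ∀ t : M ⊗[R] C,
      TensorProduct.rid R M ((LinearMap.mul' R R ∘ₗ
        TensorProduct.map f.ofConv g.ofConv).lTensor M (TensorProduct.assoc R M C C
          (M.coact.rTensor C t))) =
      M.dualAct f.ofConv (TensorProduct.rid R M (g.ofConv.lTensor M t)) := by
    intro t
    induction t with
    | zero => simp
    | add s t hs ht => simp only [map_add, hs, ht]
    | tmul a b => rw [LinearMap.rTensor_tmul, h1]; simp [dualAct]
  have h3 := DFunLike.congr_fun M.coassoc m
  simp only [LinearMap.comp_apply, LinearEquiv.coe_coe] at h3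
  change _ = M.dualAct f.ofConv (TensorProduct.rid R M (g.ofConv.lTensor M (M.coact m)))
  rw [← h2, h3, ← LinearMap.comp_apply, ← LinearMap.lTensor_comp]
  rfl

lemma Hom.map_dualAct {M N : RightComod R C} (φ : Hom M N) (f : C →ₗ[R] R) (m : M) :
    φ.toLinearMap (M.dualAct f m) = N.dualAct f (φ.toLinearMap m) := by
  have h : ∀ t : M ⊗[R] C, φ.toLinearMap (TensorProduct.rid R M (f.lTensor M t)) =
      TensorProduct.rid R N (f.lTensor N (φ.toLinearMap.rTensor C t)) := by
    intro t
    induction t with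
    | zero => simp
    | add s t hs ht => simp only [map_add, hs, ht]
    | tmul a b => simp
  have h' := DFunLike.congr_fun φ.comm m
  simp only [LinearMap.comp_apply] at h'
  simp [dualAct, h, h']

/-- A right `C`-comodule is a left `C^*`-module through `f m = ∑ m₀ f(m₁)`. -/
@[reducible] def dualModule (M : RightComod R C) : Module (DualAlg R C) M where
  smul f m := M.dualAct f.ofConv m
  one_smul m := M.dualAct_counit m
  mul_smul f g m := M.dualAct_mul f g m
  smul_zero f := map_zero _
  smul_add f := map_add _
  add_smul f g m := by
    change M.dualAct (f.ofConv + g.ofConv) m = M.dualAct f.ofConv m + M.dualAct g.ofConv m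
    simp [dualAct, LinearMap.lTensor_add]
  zero_smul m := by
    change M.dualAct 0 m = 0
    simp [dualAct]

variable (R C) in
/-- The functor `𝓜^C → _{C^*}𝓜`, identity on underlying abelian groups and maps. -/
def toDual : RightComod R C ⥤ ModuleCat.{u} (DualAlg R C) where
  obj M := letI := M.dualModule; ModuleCat.of (DualAlg R C) M
  map {M N} f := letI := M.dualModule; letI := N.dualModule
    ModuleCat.ofHom
      { toFun := f.toLinearMap
        map_add' := map_add _
        map_smul' := fun a m => Hom.map_dualAct f a.ofConv m }

end RightComod

variable (R C) in
/-- `C` as a left `C^*`-module: `f ⇀ c = ∑ c₁ f(c₂)`. -/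
def regularDual : ModuleCat.{u} (DualAlg R C) :=
  (RightComod.toDual R C).obj (RightComod.regular R C)

variable (R C) in
/-- The canonical pairing `(C^*, C)`. -/
def dualPairing : DualAlg R C →ₗ[R] C →ₗ[R] R := (WithConv.linearEquiv R (C →ₗ[R] R)).toLinearMap

lemma RightComod.isRational_toDual (M : RightComod R C) :
    IsRational (dualPairing R C) ((RightComod.toDual R C).obj M) := by
  let i1 : Module (DualAlg R C) M := M.dualModule
  have key : ∀ (inst : Module R M) (_ : inst = M.module)
      (_ : @IsScalarTower R (DualAlg R C) M _ _ inst.toSMul),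
      @rat R (DualAlg R C) C _ _ _ _ _ (dualPairing R C) M _ inst i1 _ = ⊤ := by
    rintro _ rfl _
    rw [eq_top_iff]
    rintro m -
    refine ⟨M.coact m, ?_⟩
    ext f
    change _ = TensorProduct.rid R M (f.ofConv.lTensor M (M.coact m))
    generalize M.coact m = t
    induction t with
    | zero => simp
    | add s t hs ht => simp only [map_add, LinearMap.add_apply, hs, ht]
    | tmul a b => simp [dualPairing, WithConv.linearEquiv]
  refine key _ ?_ _
  refine Module.ext' _ _ fun (r : R) (m : M) => ?_
  change M.dualAct (r • Coalgebra.counit) m = r • m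
  conv_rhs => rw [← M.dualAct_counit m]
  simp only [dualAct, LinearMap.lTensor_smul, LinearMap.comp_smul, LinearMap.smul_comp,
    LinearMap.smul_apply]

variable (R C) in
/-- The functor `𝓜^C → Rat^C(_{C^*}𝓜)`. -/
def RightComod.toRat : RightComod R C ⥤ (IsRational (dualPairing R C)).FullSubcategory :=
  ObjectProperty.lift _ (RightComod.toDual R C) RightComod.isRational_toDual

variable (R C) in
/-- The finite topology on `C^*`, induced by `C^* ↪ R^C` with `R` discrete. -/
@[reducible] def finiteTopology : TopologicalSpace (DualAlg R C) :=
  TopologicalSpace.induced (fun f (c : C) => f.ofConv c)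
    (@Pi.topologicalSpace C (fun _ => R) (fun _ => ⊥))

end Comodules

/-! ## Affine group schemes -/

/-- An affine group scheme over `R`: a group functor on commutative `R`-algebras which is
represented (as a set-valued functor) by a commutative `R`-algebra, its coordinate ring. -/
structure AffineGroupScheme (R : Type u) [CommRing R] where
  /-- the group functor -/
  points : CommAlgCat.{u} R ⥤ GrpCat.{u}
  /-- the coordinate ring -/
  coordRing : CommAlgCat.{u} R
  /-- the identification of the points with `Alg_R(coordRing, -)` -/
  corep : (points ⋙ forget GrpCat).CorepresentableBy coordRing

namespace AffineGroupScheme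

variable {R : Type u} [CommRing R] (G : AffineGroupScheme R)

/-- The `A`-point of `G` given by an algebra map `R(G) → A`. -/
def pt {A : Type u} [CommRing A] [Algebra R A] (φ : G.coordRing →ₐ[R] A) :
    G.points.obj (CommAlgCat.of R A) :=
  G.corep.homEquiv (CommAlgCat.ofHom φ)

/-- The algebra map `R(G) → A` which belongs to an `A`-point of `G`. -/
def ev {A : Type u} [CommRing A] [Algebra R A] (g : G.points.obj (CommAlgCat.of R A)) :
    G.coordRing →ₐ[R] A :=
  CommAlgCat.Hom.hom ((G.corep.homEquiv (Y := CommAlgCat.of R A)).symm g)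

section

variable {A B : Type u} [CommRing A] [Algebra R A] [CommRing B] [Algebra R B]

lemma pt_ev (g : G.points.obj (CommAlgCat.of R A)) : G.pt (G.ev g) = g :=
  (G.corep.homEquiv (Y := CommAlgCat.of R A)).apply_symm_apply g

lemma ev_pt (φ : G.coordRing →ₐ[R] A) : G.ev (G.pt φ) = φ := by
  unfold ev pt
  rw [Equiv.symm_apply_apply]; rfl

lemma pt_injective : Function.Injective (G.pt (A := A)) :=
  Function.LeftInverse.injective G.ev_pt

lemma map_pt (ψ : A →ₐ[R] B) (φ : G.coordRing →ₐ[R] A) :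
    G.points.map (CommAlgCat.ofHom ψ) (G.pt φ) = G.pt (ψ.comp φ) :=
  (G.corep.homEquiv_comp (CommAlgCat.ofHom ψ) (CommAlgCat.ofHom φ)).symm

lemma ev_map (ψ : A →ₐ[R] B) (g : G.points.obj (CommAlgCat.of R A)) :
    G.ev (G.points.map (CommAlgCat.ofHom ψ) g) = ψ.comp (G.ev g) := by
  apply G.pt_injective
  rw [pt_ev, ← map_pt, pt_ev]

end

/-- The comultiplication of `R(G)`: the product of the two universal points in
`G(R(G) ⊗ R(G))`. -/
def comulHom : G.coordRing →ₐ[R] G.coordRing ⊗[R] G.coordRing :=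
  G.ev (G.pt Algebra.TensorProduct.includeLeft * G.pt Algebra.TensorProduct.includeRight)

/-- The counit of `R(G)`: the neutral element of `G(R)`. -/
def counitHom : G.coordRing →ₐ[R] R := G.ev 1

section

variable {A B : Type u} [CommRing A] [Algebra R A] [CommRing B] [Algebra R B]

lemma pt_comp_comulHom (ψ : G.coordRing ⊗[R] G.coordRing →ₐ[R] A) :
    G.pt (ψ.comp G.comulHom) = G.pt (ψ.comp Algebra.TensorProduct.includeLeft) *
      G.pt (ψ.comp Algebra.TensorProduct.includeRight) := by
  rw [← map_pt, comulHom, pt_ev, map_mul, map_pt, map_pt]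

lemma pt_comp_counitHom (ψ : R →ₐ[R] A) : G.pt (ψ.comp G.counitHom) = 1 := by
  rw [← map_pt, counitHom, pt_ev, map_one]

lemma ev_mul (g h : G.points.obj (CommAlgCat.of R A)) :
    G.ev (g * h) = (Algebra.TensorProduct.productMap (G.ev g) (G.ev h)).comp G.comulHom := by
  apply G.pt_injective
  rw [pt_comp_comulHom, pt_ev, Algebra.TensorProduct.productMap_left,
    Algebra.TensorProduct.productMap_right, pt_ev, pt_ev]

lemma ev_one : G.ev (1 : G.points.obj (CommAlgCat.of R A)) =
    (Algebra.ofId R A).comp G.counitHom := by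
  apply G.pt_injective
  rw [pt_comp_counitHom, pt_ev]

end

lemma comulHom_coassoc :
    ((Algebra.TensorProduct.assoc R R R G.coordRing G.coordRing G.coordRing).toAlgHom.comp
      (Algebra.TensorProduct.map G.comulHom (.id R _))).comp G.comulHom =
    (Algebra.TensorProduct.map (.id R G.coordRing) G.comulHom).comp G.comulHom := by
  apply G.pt_injective
  rw [pt_comp_comulHom, pt_comp_comulHom]
  have e1 : ((Algebra.TensorProduct.assoc R R R G.coordRing G.coordRing G.coordRing).toAlgHom.comp
      (Algebra.TensorProduct.map G.comulHom (.id R _))).comp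
        Algebra.TensorProduct.includeLeft =
      ((Algebra.TensorProduct.assoc R R R G.coordRing G.coordRing G.coordRing).toAlgHom.comp
        Algebra.TensorProduct.includeLeft).comp G.comulHom := by
    ext x; simp
  have e2 : (Algebra.TensorProduct.map (.id R G.coordRing) G.comulHom).comp
        Algebra.TensorProduct.includeRight =
      (Algebra.TensorProduct.includeRight : _ →ₐ[R] G.coordRing ⊗[R] _).comp G.comulHom := by
    ext x; simp
  rw [e1, e2, pt_comp_comulHom, pt_comp_comulHom, mul_assoc]
  refine congrArg₂ (· * ·) (congrArg G.pt ?_) (congrArg₂ (· * ·) (congrArg G.pt ?_)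
    (congrArg G.pt ?_)) <;>
  · apply AlgHom.ext
    intro x
    simp [Algebra.TensorProduct.one_def]

lemma counit_comulHom :
    (Algebra.TensorProduct.map G.counitHom (.id R G.coordRing)).comp G.comulHom =
      Algebra.TensorProduct.includeRight := by
  apply G.pt_injective
  rw [pt_comp_comulHom]
  have e1 : (Algebra.TensorProduct.map G.counitHom (.id R G.coordRing)).comp
        Algebra.TensorProduct.includeLeft =
      (Algebra.TensorProduct.includeLeft : R →ₐ[R] R ⊗[R] G.coordRing).comp G.counitHom := by
    ext x; simp
  rw [e1, pt_comp_counitHom, one_mul]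
  congr 1
  ext x; simp

lemma comulHom_counit :
    (Algebra.TensorProduct.map (.id R G.coordRing) G.counitHom).comp G.comulHom =
      Algebra.TensorProduct.includeLeft := by
  apply G.pt_injective
  rw [pt_comp_comulHom]
  have e1 : (Algebra.TensorProduct.map (.id R G.coordRing) G.counitHom).comp
        Algebra.TensorProduct.includeRight =
      (Algebra.TensorProduct.includeRight : R →ₐ[R] G.coordRing ⊗[R] R).comp G.counitHom := by
    ext x; simp
  rw [e1, pt_comp_counitHom, mul_one]
  congr 1
  ext x; simp

/-- The coalgebra structure of the coordinate ring. -/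
instance : Coalgebra R G.coordRing where
  comul := G.comulHom.toLinearMap
  counit := G.counitHom.toLinearMap
  coassoc := by
    ext x; exact DFunLike.congr_fun G.comulHom_coassoc x
  rTensor_counit_comp_comul := by
    ext x; exact DFunLike.congr_fun G.counit_comulHom x
  lTensor_counit_comp_comul := by
    ext x; exact DFunLike.congr_fun G.comulHom_counit x

/-- The augmentation ideal `ω`. -/
def augIdeal : Ideal G.coordRing := RingHom.ker G.counitHom

lemma comul_mem_of_mem_augIdeal_pow (k : ℕ) (x : G.coordRing) (hx : x ∈ G.augIdeal ^ k) :
    G.comulHom x ∈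
      (G.augIdeal.map (Algebra.TensorProduct.includeLeft :
          G.coordRing →ₐ[R] G.coordRing ⊗[R] G.coordRing) ⊔
        G.augIdeal.map (Algebra.TensorProduct.includeRight :
          G.coordRing →ₐ[R] G.coordRing ⊗[R] G.coordRing)) ^ k := by
  set J := G.augIdeal.map (Algebra.TensorProduct.includeLeft :
          G.coordRing →ₐ[R] G.coordRing ⊗[R] G.coordRing) ⊔
        G.augIdeal.map (Algebra.TensorProduct.includeRight :
          G.coordRing →ₐ[R] G.coordRing ⊗[R] G.coordRing) with hJ
  have key : ∀ z : G.coordRing ⊗[R] G.coordRing,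
      z - algebraMap R _ (Algebra.TensorProduct.lift G.counitHom G.counitHom
        (fun _ _ => Commute.all _ _) z) ∈ J := by
    intro z
    induction z with
    | zero => simp
    | add a b ha hb =>
      rw [map_add, map_add, add_sub_add_comm]; exact J.add_mem ha hb
    | tmul a b =>
      have h1 : ((a - algebraMap R _ (G.counitHom a)) ⊗ₜ[R] (1 : G.coordRing)) ∈ J :=
        (le_sup_left : _ ≤ J) (Ideal.mem_map_of_mem
          (Algebra.TensorProduct.includeLeft :
            G.coordRing →ₐ[R] G.coordRing ⊗[R] G.coordRing) (by simp [augIdeal]))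
      have h2 : ((1 : G.coordRing) ⊗ₜ[R] (b - algebraMap R _ (G.counitHom b))) ∈ J :=
        (le_sup_right : _ ≤ J) (Ideal.mem_map_of_mem
          (Algebra.TensorProduct.includeRight :
            G.coordRing →ₐ[R] G.coordRing ⊗[R] G.coordRing) (by simp [augIdeal]))
      have := J.add_mem (J.mul_mem_right (1 ⊗ₜ b) h1)
        (J.mul_mem_left (algebraMap R _ (G.counitHom a)) h2)
      convert this using 1
      simp only [Algebra.TensorProduct.lift_tmul, Algebra.algebraMap_eq_smul_one,
        TensorProduct.sub_tmul, TensorProduct.tmul_sub, TensorProduct.tmul_smul,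
        ← TensorProduct.smul_tmul', sub_mul, mul_sub, smul_mul_assoc, one_mul, mul_one,
        Algebra.TensorProduct.tmul_mul_tmul, Algebra.TensorProduct.one_def, smul_smul,
        mul_smul_comm, mul_comm (G.counitHom b)]
      abel
  have hle : G.augIdeal ≤ J.comap G.comulHom := by
    intro y hy
    have h := key (G.comulHom y)
    have h0 : Algebra.TensorProduct.lift G.counitHom G.counitHom
        (fun _ _ => Commute.all _ _) (G.comulHom y) = G.counitHom y := by
      have := DFunLike.congr_fun G.counit_comulHom y
      have h3 : Algebra.TensorProduct.lift G.counitHom G.counitHom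
          (fun _ _ => Commute.all _ _) = (Algebra.TensorProduct.lift (.id R R) G.counitHom
          (fun _ _ => Commute.all _ _)).comp
            (Algebra.TensorProduct.map G.counitHom (.id R G.coordRing)) := by
        ext <;> simp
      rw [h3]
      simp only [AlgHom.comp_apply] at this ⊢
      rw [this]; simp
    have hy0 : G.counitHom y = 0 := hy
    rw [h0, hy0, map_zero, sub_zero] at h
    exact h
  exact (Ideal.pow_right_mono hle k |>.trans (Ideal.le_comap_pow G.comulHom k)) hx

/-- The hyperalgebra `hy(G)`: the subalgebra of `R(G)^*` of the linear forms which vanish on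
some power `ω ^ n`, `n ≥ 1`, of the augmentation ideal. -/
def hy : Subalgebra R (DualAlg R G.coordRing) where
  carrier := {f | ∃ n : ℕ, 1 ≤ n ∧ ∀ x ∈ G.augIdeal ^ n, f.ofConv x = 0}
  mul_mem' := by
    rintro f g ⟨n, hn, hf⟩ ⟨m, hm, hg⟩
    refine ⟨n + m, by omega, fun x hx => ?_⟩
    have h := Ideal.sup_pow_add_le_pow_sup_pow (G.comul_mem_of_mem_augIdeal_pow _ x hx)
    rw [← Ideal.map_pow, ← Ideal.map_pow] at h
    have hl : ∀ a ∈ (G.augIdeal ^ n).map (Algebra.TensorProduct.includeLeft :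
        G.coordRing →ₐ[R] G.coordRing ⊗[R] G.coordRing), ∀ z,
        LinearMap.mul' R R (TensorProduct.map f.ofConv g.ofConv (z * a)) = 0 := by
      intro a ha
      refine Submodule.span_induction ?_ (by simp) ?_ ?_ ha
      · rintro _ ⟨y, hy, rfl⟩ z
        induction z with
        | zero => simp
        | add z z' hz hz' => rw [add_mul, map_add, map_add, hz, hz', add_zero]
        | tmul c d => simp [hf _ (Ideal.mul_mem_left _ c hy)]
      · intro x y _ _ hx hy z; rw [mul_add, map_add, map_add, hx, hy, add_zero]
      · intro r x _ hx z; rw [smul_eq_mul, ← mul_assoc, hx]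
    have hr : ∀ a ∈ (G.augIdeal ^ m).map (Algebra.TensorProduct.includeRight :
        G.coordRing →ₐ[R] G.coordRing ⊗[R] G.coordRing), ∀ z,
        LinearMap.mul' R R (TensorProduct.map f.ofConv g.ofConv (z * a)) = 0 := by
      intro a ha
      refine Submodule.span_induction ?_ (by simp) ?_ ?_ ha
      · rintro _ ⟨y, hy, rfl⟩ z
        induction z with
        | zero => simp
        | add z z' hz hz' => rw [add_mul, map_add, map_add, hz, hz', add_zero]
        | tmul c d => simp [hg _ (Ideal.mul_mem_left _ d hy)]
      · intro x y _ _ hx hy z; rw [mul_add, map_add, map_add, hx, hy, add_zero]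
      · intro r x _ hx z; rw [smul_eq_mul, ← mul_assoc, hx]
    obtain ⟨a, ha, b, hb, hab⟩ := Submodule.mem_sup.1 h
    change LinearMap.mul' R R (TensorProduct.map f.ofConv g.ofConv (G.comulHom x)) = 0
    rw [← hab, map_add, map_add, ← one_mul a, ← one_mul b, hl a ha, hr b hb, add_zero]
  add_mem' := by
    rintro f g ⟨n, hn, hf⟩ ⟨m, hm, hg⟩
    refine ⟨max n m, le_max_of_le_left hn, fun x hx => ?_⟩
    rw [WithConv.ofConv_add, LinearMap.add_apply, hf x (Ideal.pow_le_pow_right (le_max_left _ _) hx),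
      hg x (Ideal.pow_le_pow_right (le_max_right _ _) hx), add_zero]
  algebraMap_mem' r := by
    refine ⟨1, le_rfl, fun x hx => ?_⟩
    rw [pow_one] at hx
    have hx0 : G.counitHom x = 0 := hx
    change r • (algebraMap R R (G.counitHom x)) = 0
    rw [hx0, map_zero, smul_zero]

/-- The canonical pairing `(hy(G), R(G))`. -/
def hyPairing : G.hy →ₗ[R] G.coordRing →ₗ[R] R :=
  restrictPairing (dualPairing R G.coordRing) G.hy

/-- `G` satisfies the `α`-condition (is an affine `α`-group scheme). -/
def IsAlpha : Prop :=
  AlphaCondition (V := G.hy) (W := G.coordRing) G.hyPairing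

/-- `G` is locally projective. -/
def LocallyProjective : Prop := IsLocallyProjective R G.coordRing

/-- `G` is connected: `hy(G)` is dense in `R(G)^*` for the finite topology. -/
def Connected : Prop :=
  @Dense _ (finiteTopology R G.coordRing) (G.hy : Set (DualAlg R G.coordRing))

/-- The canonical map `R(G) → hy(G)^*`, `c ↦ (f ↦ f(c))`. -/
def chi : G.coordRing →ₗ[R] G.hy →ₗ[R] R :=
  G.hyPairing.flip

/-! ### `G`-modules -/

/-- Left `G`-modules: an `R`-module `M` with, for every commutative `R`-algebra `A`, a left action
of the group `G(A)` on `A ⊗ M` by `A`-linear maps, functorial in `A`. -/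
structure Mod where
  /-- the underlying module -/
  carrier : Type u
  [addCommGroup : AddCommGroup carrier]
  [module : Module R carrier]
  /-- the actions -/
  ρ (A : CommAlgCat.{u} R) : G.points.obj A →* Module.End A (A ⊗[R] carrier)
  natural {A B : CommAlgCat.{u} R} (φ : A ⟶ B) (g : G.points.obj A) (x : A ⊗[R] carrier) :
    φ.hom.toLinearMap.rTensor carrier (ρ A g x) =
      ρ B (G.points.map φ g) (φ.hom.toLinearMap.rTensor carrier x)

namespace Mod

variable {G}

instance : CoeSort G.Mod (Type u) := ⟨carrier⟩

attribute [instance] addCommGroup module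

/-- `G`-linear maps. -/
@[ext] structure Hom (M N : G.Mod) where
  /-- the underlying linear map -/
  toLinearMap : M →ₗ[R] N
  comm (A : CommAlgCat.{u} R) (g : G.points.obj A) (x : A ⊗[R] M) :
    toLinearMap.lTensor A (M.ρ A g x) = N.ρ A g (toLinearMap.lTensor A x)

/-- The category `_G 𝓜` of left `G`-modules. -/
instance : Category G.Mod where
  Hom := Hom
  id M := ⟨LinearMap.id, by simp⟩
  comp f g := ⟨g.toLinearMap ∘ₗ f.toLinearMap, by
    intro A a x
    simp only [LinearMap.lTensor_comp, LinearMap.comp_apply, f.comm, g.comm]⟩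

end Mod

section Action

variable {G}

/-- For a right `R(G)`-comodule `M` and an algebra map `φ : R(G) → A`, the map
`M → A ⊗ M`, `m ↦ ∑ φ(m₁) ⊗ m₀`. -/
def comodAct (M : RightComod R G.coordRing) {A : Type u} [CommRing A] [Algebra R A]
    (φ : G.coordRing →ₐ[R] A) : M →ₗ[R] A ⊗[R] M :=
  (TensorProduct.comm R M A).toLinearMap ∘ₗ φ.toLinearMap.lTensor M ∘ₗ M.coact

lemma comodAct_counit (M : RightComod R G.coordRing) (A : Type u) [CommRing A] [Algebra R A]
    (m : M) : comodAct M ((Algebra.ofId R A).comp G.counitHom) m = 1 ⊗ₜ m := by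
  have h : ∀ t : M ⊗[R] G.coordRing, TensorProduct.comm R M A
      (((Algebra.ofId R A).comp G.counitHom).toLinearMap.lTensor M t) =
      1 ⊗ₜ TensorProduct.rid R M (G.counitHom.toLinearMap.lTensor M t) := by
    intro t
    induction t with
    | zero => simp
    | add s t hs ht => simp only [map_add, hs, ht, TensorProduct.tmul_add]
    | tmul a b => simp [Algebra.ofId_apply, Algebra.algebraMap_eq_smul_one]
  have h' := DFunLike.congr_fun M.counital m
  exact (h _).trans (congrArg _ h')

lemma comodAct_mul (M : RightComod R G.coordRing) {A : Type u} [CommRing A] [Algebra R A]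
    (φ ψ : G.coordRing →ₐ[R] A) (m : M) :
    comodAct M ((Algebra.TensorProduct.productMap φ ψ).comp G.comulHom) m =
      (comodAct M φ).liftBaseChange A (comodAct M ψ m) := by
  have h1 : ∀ (s : M ⊗[R] G.coordRing) (c : G.coordRing),
      TensorProduct.comm R M A ((Algebra.TensorProduct.productMap φ ψ).toLinearMap.lTensor M
        (TensorProduct.assoc R M _ _ (s ⊗ₜ c))) =
      ψ c • TensorProduct.comm R M A (φ.toLinearMap.lTensor M s) := by
    intro s c
    induction s with
    | zero => simp
    | add s t hs ht => rw [TensorProduct.add_tmul]; simp only [map_add, hs, ht, smul_add]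
    | tmul a b => simp [TensorProduct.smul_tmul', mul_comm]
  have h2 : ∀ t : M ⊗[R] G.coordRing,
      TensorProduct.comm R M A ((Algebra.TensorProduct.productMap φ ψ).toLinearMap.lTensor M
        (TensorProduct.assoc R M _ _ (M.coact.rTensor _ t))) =
      (comodAct M φ).liftBaseChange A
        (TensorProduct.comm R M A (ψ.toLinearMap.lTensor M t)) := by
    intro t
    induction t with
    | zero => simp
    | add s t hs ht => simp only [map_add, hs, ht]
    | tmul a b => rw [LinearMap.rTensor_tmul, h1]; simp [comodAct]
  have h3 := DFunLike.congr_fun M.coassoc m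
  simp only [LinearMap.comp_apply, LinearEquiv.coe_coe] at h3
  change _ = (comodAct M φ).liftBaseChange A
    (TensorProduct.comm R M A (ψ.toLinearMap.lTensor M (M.coact m)))
  rw [← h2, h3, ← LinearMap.comp_apply (LinearMap.lTensor _ _), ← LinearMap.lTensor_comp]
  rfl

lemma comodAct_comp (M : RightComod R G.coordRing) {A B : Type u} [CommRing A] [Algebra R A]
    [CommRing B] [Algebra R B] (φ : G.coordRing →ₐ[R] A) (ψ : A →ₐ[R] B) (m : M) :
    comodAct M (ψ.comp φ) m = ψ.toLinearMap.rTensor M (comodAct M φ m) := by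
  change TensorProduct.comm R M B ((ψ.comp φ).toLinearMap.lTensor M (M.coact m)) =
    ψ.toLinearMap.rTensor M (TensorProduct.comm R M A (φ.toLinearMap.lTensor M (M.coact m)))
  generalize M.coact m = t
  induction t with
  | zero => simp
  | add s t hs ht => simp only [map_add, hs, ht]
  | tmul a b => simp

lemma comodAct_hom {M N : RightComod R G.coordRing} (f : RightComod.Hom M N) {A : Type u}
    [CommRing A] [Algebra R A] (φ : G.coordRing →ₐ[R] A) (m : M) :
    f.toLinearMap.lTensor A (comodAct M φ m) = comodAct N φ (f.toLinearMap m) := by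
  have h' := DFunLike.congr_fun f.comm m
  simp only [LinearMap.comp_apply] at h'
  change f.toLinearMap.lTensor A (TensorProduct.comm R M A
    (φ.toLinearMap.lTensor M (M.coact m))) =
    TensorProduct.comm R N A (φ.toLinearMap.lTensor N (N.coact (f.toLinearMap m)))
  rw [h']
  generalize M.coact m = t
  induction t with
  | zero => simp
  | add s t hs ht => simp only [map_add, hs, ht]
  | tmul a b => simp

end Action

/-- The canonical functor `𝓜^{R(G)} → _G 𝓜`: a point `g : R(G) → A` acts on `A ⊗ M` by
`a ⊗ m ↦ ∑ a g(m₁) ⊗ m₀`. -/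
def comodToMod : RightComod R G.coordRing ⥤ G.Mod where
  obj M :=
    { carrier := M
      ρ := fun A =>
        { toFun := fun g => (comodAct M (G.ev (A := A) g)).liftBaseChange A
          map_one' := by
            refine TensorProduct.AlgebraTensorModule.curry_injective ?_
            ext m
            simp [ev_one, comodAct_counit]
          map_mul' := fun g h => by
            refine TensorProduct.AlgebraTensorModule.curry_injective ?_
            ext m
            simpa using (congrArg (fun φ => comodAct M φ m) (G.ev_mul (A := A) g h)).trans
              (comodAct_mul M _ _ m) }
      natural := fun {A B} φ g x => by
        have hφ : G.ev (A := B) (G.points.map φ g) = φ.hom.comp (G.ev (A := A) g) :=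
          G.ev_map φ.hom g
        induction x with
        | zero => simp
        | add x y hx hy => simp only [map_add, hx, hy]
        | tmul a m =>
          change φ.hom.toLinearMap.rTensor M (a • comodAct M (G.ev (A := A) g) m) =
            φ.hom a • comodAct M (G.ev (A := B) (G.points.map φ g)) m
          rw [hφ, comodAct_comp]
          generalize comodAct M (G.ev (A := A) g) m = t
          induction t with
          | zero => simp
          | add s t hs ht => simp only [map_add, smul_add, hs, ht]
          | tmul b n => simp [TensorProduct.smul_tmul'] }
  map {M N} f :=
    { toLinearMap := f.toLinearMap
      comm := fun A g x => by
        induction x with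
        | zero => simp
        | add x y hx hy => simp only [map_add, hx, hy]
        | tmul a m =>
          change f.toLinearMap.lTensor A (a • comodAct M (G.ev (A := A) g) m) =
            a • comodAct N (G.ev (A := A) g) (f.toLinearMap m)
          rw [← comodAct_hom]
          generalize comodAct M (G.ev (A := A) g) m = t
          induction t with
          | zero => simp
          | add s t hs ht => simp only [map_add, smul_add, hs, ht]
          | tmul b n => simp [TensorProduct.smul_tmul'] }

end AffineGroupScheme

end

/-! Everything is controlled by dual bases on finite subsets: for finite `F ⊆ H` one asks for forms
`f_j` and elements `w_j` with `c = ∑ f_j(c) w_j` for all `c ∈ F`. Local projectivity means that such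
data exist with `f_j ∈ H^*`. The `α`-condition means that the `f_j` can be taken in `hy(G)`
(`alphaCondition_iff`). For a submodule `T ⊆ H^*`, dual bases in `T` amount to local projectivity
together with density of `T` (`hasDualBasesIn_iff`), because density says exactly that every form
agrees on a given finite set with a form from `T`. This is the criterion in 2.

Under the `α`-condition a tensor in `M ⊗ H` is determined by its evaluations. A rational module then
has a unique coaction, and associativity and unitality of the action become coassociativity and
counitality (`exists_restrictScalars_toDual_eq`). Rational modules are closed under submodules,
quotients and direct sums. Conversely, the coaction embeds a comodule `M` into `M ⊗ H`, a quotient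
of copies of `H`, so that rational and subgenerated modules coincide. The passage between comodules
and `G`-modules is Yoneda: an action is determined by the action of the universal point.

For restriction to a subalgebra `B`, the modules in question are continuous: each element is
annihilated by every form that vanishes on a suitable finite set. If `B` is dense, any `a` acts on
finitely many elements like some `b ∈ B`. Hence `B`-linear maps are `A`-linear, and `B`-actions on
subobjects and quotients extend uniquely. Conversely, if restriction on `σ` is full and surjective
on objects, applying this to a cyclic `B`-submodule of a sum of copies of `H` recovers density,
since `ε(f ⇀ c) = f(c)`. Over a cogenerator, density, injectivity of `H → hy(G)^*` and the Hausdorff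
property are compared by separating points from submodules with linear forms. -/

noncomputable section

/-! ### Local dual bases, the `α`-condition and local projectivity -/

section DualBases

variable {R V W : Type u} [CommRing R] [AddCommGroup V] [Module R V] [AddCommGroup W] [Module R W]

lemma alphaMap_rTensor (κ : V →ₗ[R] W →ₗ[R] R) {M N : Type u} [AddCommGroup M] [Module R M]
    [AddCommGroup N] [Module R N] (g : M →ₗ[R] N) (t : M ⊗[R] W) (v : V) :
    alphaMap κ N (g.rTensor W t) v = g (alphaMap κ M t v) := by
  induction t with
  | zero => simp
  | add s t hs ht => simp only [map_add, LinearMap.add_apply, hs, ht]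
  | tmul m w => simp

/-- Dual bases on finite subsets of `W`, with coordinate forms from `V`. -/
def HasLocalDualBases (κ : V →ₗ[R] W →ₗ[R] R) : Prop :=
  ∀ F : Finset W, ∃ (ι : Type u) (_ : Fintype ι) (v : ι → V) (w : ι → W),
    ∀ c ∈ F, c = ∑ j, κ (v j) c • w j

/-- The condition is tested on the cokernel of the evaluation `V → R^F`. The tensor `∑ e_c ⊗ c`
evaluates at `v` to the image of `v` in `R^F`, so it dies in the cokernel. By right exactness it
lifts to `V ⊗ W`, and the simple tensors of a lift are the dual basis. -/
lemma AlphaCondition.hasLocalDualBases {κ : V →ₗ[R] W →ₗ[R] R} (h : AlphaCondition κ) :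
    HasLocalDualBases κ := by
  classical
  intro F
  let f : V →ₗ[R] (F → R) := LinearMap.pi fun c => κ.flip c
  let x : (F → R) ⊗[R] W := ∑ c : F, Pi.single c 1 ⊗ₜ (c : W)
  have hx : (LinearMap.range f).mkQ.rTensor W x = 0 := by
    apply h
    ext v
    rw [alphaMap_rTensor, map_zero, LinearMap.zero_apply, Submodule.mkQ_apply,
      Submodule.Quotient.mk_eq_zero]
    refine ⟨v, ?_⟩
    ext c
    simp [x, f, Pi.single_apply]
  have hex : Function.Exact f (LinearMap.range f).mkQ :=
    LinearMap.exact_iff.2 (Submodule.ker_mkQ _)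
  obtain ⟨y, hy⟩ := (rTensor_exact W hex (Submodule.mkQ_surjective _) x).1 hx
  obtain ⟨S, rfl⟩ := TensorProduct.exists_finset y
  refine ⟨S, inferInstance, fun p => p.1.1, fun p => p.1.2, fun c hc => ?_⟩
  rw [Finset.sum_coe_sort S fun p => κ p.1 c • p.2]
  have := congrArg (fun z => TensorProduct.lid R W ((LinearMap.proj (⟨c, hc⟩ : F)).rTensor W z)) hy
  simp only [map_sum, LinearMap.rTensor_tmul, x] at this
  simpa [f, Pi.single_apply] using this.symm

/-- Dual bases for the second components of `t` reconstruct `t` from its values under `alphaMap`. -/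
lemma HasLocalDualBases.alphaCondition {κ : V →ₗ[R] W →ₗ[R] R} (h : HasLocalDualBases κ) :
    AlphaCondition κ := by
  classical
  intro M _ _
  rw [injective_iff_map_eq_zero]
  intro t ht
  obtain ⟨T, hT⟩ := TensorProduct.exists_finset t
  obtain ⟨ι, _, v, w, hS⟩ := h (T.image Prod.snd)
  have key : t = ∑ j, alphaMap κ M t (v j) ⊗ₜ[R] w j := by
    conv_lhs => rw [hT]
    rw [hT]
    simp only [map_sum, LinearMap.sum_apply, alphaMap_tmul, sum_tmul]
    rw [Finset.sum_comm]
    refine Finset.sum_congr rfl fun p hp => ?_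
    conv_lhs => rw [hS p.2 (Finset.mem_image_of_mem _ hp)]
    simp only [tmul_sum, tmul_smul, smul_tmul']
  rw [key, ht]
  simp

lemma HasLocalDualBases.isLocallyProjective {κ : V →ₗ[R] W →ₗ[R] R} (h : HasLocalDualBases κ) :
    IsLocallyProjective R W := by
  intro L N _ _ _ _ g hg f W₀ hW
  obtain ⟨F, rfl⟩ := hW
  obtain ⟨ι, _, v, w, hS⟩ := h F
  -- The lift sends `x` to `∑ κ(v_j)(x) l_j`, where `l_j` is a chosen preimage of `f(w_j)`.
  have key : ∀ x ∈ Submodule.span R (F : Set W),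
      g ((∑ j, (κ (v j)).smulRight (Function.surjInv hg (f (w j)))) x) = f x := by
    intro x hx
    induction hx using Submodule.span_induction with
    | mem x hx =>
      conv_rhs => rw [hS x hx]
      simp [LinearMap.sum_apply, Function.surjInv_eq hg]
    | zero => simp
    | add x y _ _ hx hy => simp only [map_add, hx, hy]
    | smul r x _ hx => simp only [map_smul, hx]
  exact ⟨_, key⟩

/-- Lift the identity of `W` along the free module on the set `W`; the coordinates of the lift are
the required forms. -/
lemma IsLocallyProjective.hasLocalDualBases (h : IsLocallyProjective R W) :
    HasLocalDualBases (LinearMap.id : (W →ₗ[R] R) →ₗ[R] (W →ₗ[R] R)) := by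
  classical
  intro F
  obtain ⟨s, hs⟩ := h (W →₀ R) W (Finsupp.linearCombination R id)
    (fun w => ⟨Finsupp.single w 1, by simp⟩) LinearMap.id (Submodule.span R F) ⟨F, rfl⟩
  let J : Finset W := F.biUnion fun c => (s c).support
  refine ⟨J, inferInstance, fun w => Finsupp.lapply (w : W) ∘ₗ s, fun w => w, fun c hc => ?_⟩
  refine Eq.trans ?_ (Finset.sum_coe_sort J fun w => s c w • w).symm
  have := hs c (Submodule.subset_span hc)
  rw [LinearMap.id_apply, Finsupp.linearCombination_apply,
    Finsupp.sum_of_support_subset (s := J) _ 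
      (Finset.subset_biUnion_of_mem (fun c => (s c).support) hc) _ (by simp)] at this
  simpa using this.symm

end DualBases

/-! ### Density in the finite topology -/

section Density

variable {R C : Type u} [CommRing R] [AddCommGroup C] [Module R C]

lemma dense_finiteTopology_iff (B : Set (DualAlg R C)) :
    @Dense _ (finiteTopology R C) B ↔
      ∀ (f : DualAlg R C) (F : Finset C), ∃ b ∈ B, ∀ c ∈ F, b.ofConv c = f.ofConv c := by
  let : TopologicalSpace R := ⊥
  have : DiscreteTopology R := ⟨rfl⟩
  let := finiteTopology R C
  have hi : Topology.IsInducing (fun (f : DualAlg R C) (c : C) => f.ofConv c) := ⟨rfl⟩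
  constructor
  · intro h f F
    have ho : IsOpen {g : DualAlg R C | ∀ c ∈ F, g.ofConv c = f.ofConv c} := by
      have : {g : DualAlg R C | ∀ c ∈ F, g.ofConv c = f.ofConv c} =
          ⋂ c ∈ F, (fun g : DualAlg R C => g.ofConv c) ⁻¹' {f.ofConv c} := by
        ext; simp
      rw [this]
      exact isOpen_biInter_finset fun c _ =>
        (isOpen_discrete _).preimage ((continuous_apply c).comp hi.continuous)
    obtain ⟨b, hb, hB⟩ := h.inter_open_nonempty _ ho ⟨f, fun _ _ => rfl⟩
    exact ⟨b, hB, hb⟩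
  · intro h
    rw [dense_iff_inter_open]
    rintro U hU ⟨f, hf⟩
    obtain ⟨O, hO, rfl⟩ := hi.isOpen_iff.1 hU
    obtain ⟨F, u, hu, hFu⟩ := isOpen_pi_iff.1 hO _ hf
    obtain ⟨b, hb, hbF⟩ := h f F
    refine ⟨b, hFu fun c hc => ?_, hb⟩
    change b.ofConv c ∈ u c
    rw [hbF c hc]
    exact (hu c hc).2

end Density

/-! ### Equality of bundled modules -/

section ModuleCatEq

variable {A : Type u} [Ring A]

lemma ModuleCat.of_congr {M : Type u} (i i' : AddCommGroup M) (j : @Module A M _ i.toAddCommMonoid)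
    (j' : @Module A M _ i'.toAddCommMonoid) (hi : ∀ x y, i.add x y = i'.add x y)
    (hj : ∀ a x, j.smul a x = j'.smul a x) :
    @ModuleCat.of A _ M i j = @ModuleCat.of A _ M i' j' := by
  obtain rfl : i = i' := by ext x y; exact hi x y
  obtain rfl : j = j' := Module.ext' _ _ hj
  rfl

/-- Isomorphisms of categories require injectivity on objects, hence actual equality of bundled
modules. It suffices that the transport between the carriers is linear. -/
lemma ModuleCat.eq_of_cast {M N : ModuleCat.{u} A} (e : (M : Type u) = N)
    (f : M →ₗ[A] N) (hf : ∀ x, f x = cast e x) : M = N := by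
  -- Linearity is restated through `cast` alone, so that `f` can be discarded before the carriers
  -- are identified.
  have hadd : ∀ x y, cast e (x + y) = cast e x + cast e y := fun x y => by
    simp only [← hf, map_add]
  have hsmul : ∀ (a : A) x, cast e (a • x) = a • cast e x := fun a x => by
    simp only [← hf, map_smul]
  clear hf f
  rcases M with @⟨M, iM, jM⟩
  rcases N with @⟨N, iN, jN⟩
  dsimp only at e
  subst e
  exact ModuleCat.of_congr _ _ _ _ hadd hsmul

lemma ModuleCat.exists_cast {M N : ModuleCat.{u} A} (h : M = N) :
    ∃ (e : (M : Type u) = N) (f : M →ₗ[A] N), ∀ x, f x = cast e x := by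
  subst h
  exact ⟨rfl, LinearMap.id, fun _ => rfl⟩

lemma ModuleCat.of_eq_of_smul (N : ModuleCat.{u} A) (i : Module A N)
    (h : ∀ (a : A) (x : N), i.smul a x = N.isModule.smul a x) : @ModuleCat.of A _ N _ i = N :=
  ModuleCat.of_congr _ _ _ _ (fun _ _ => rfl) h

end ModuleCatEq

/-! ### Continuous modules and dense subalgebras -/

section Continuous

variable {R A C : Type u} [CommRing R] [Ring A] [Algebra R A] [AddCommGroup C] [Module R C]

/-- An `A`-module is continuous for a pairing `(A, C)` if the annihilator of every element contains
the annihilator of a finite subset of `C`. -/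
def IsContinuousModule (κ : A →ₗ[R] C →ₗ[R] R) (M : Type u) [AddCommGroup M] [Module A M] : Prop :=
  ∀ m : M, ∃ F : Finset C, ∀ a : A, (∀ c ∈ F, κ a c = 0) → a • m = 0

/-- Density of a subalgebra for the topology of pointwise convergence on `C`. -/
def IsPairingDense (κ : A →ₗ[R] C →ₗ[R] R) (B : Subalgebra R A) : Prop :=
  ∀ (a : A) (F : Finset C), ∃ b ∈ B, ∀ c ∈ F, κ b c = κ a c

variable {κ : A →ₗ[R] C →ₗ[R] R}

section

variable {M N : Type u} [AddCommGroup M] [Module A M] [AddCommGroup N] [Module A N]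

lemma IsContinuousModule.of_injective (hN : IsContinuousModule κ N) (i : M →ₗ[A] N)
    (hi : Function.Injective i) : IsContinuousModule κ M := by
  intro m
  obtain ⟨F, hF⟩ := hN (i m)
  exact ⟨F, fun a ha => hi (by rw [map_smul, hF a ha, map_zero])⟩

lemma IsContinuousModule.of_surjective (hM : IsContinuousModule κ M) (g : M →ₗ[A] N)
    (hg : Function.Surjective g) : IsContinuousModule κ N := by
  intro n
  obtain ⟨m, rfl⟩ := hg n
  obtain ⟨F, hF⟩ := hM m
  exact ⟨F, fun a ha => by rw [← map_smul, hF a ha, map_zero]⟩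

lemma IsContinuousModule.finsupp (hM : IsContinuousModule κ M) (Λ : Type u) :
    IsContinuousModule κ (Λ →₀ M) := by
  classical
  intro x
  choose F hF using hM
  refine ⟨x.support.biUnion fun l => F (x l), fun a ha => Finsupp.ext fun l => ?_⟩
  by_cases hl : x l = 0
  · simp [hl]
  · exact hF _ a fun c hc => ha c
      (Finset.mem_biUnion.2 ⟨l, Finsupp.mem_support_iff.2 hl, hc⟩)

lemma IsSubgenerated.isContinuousModule {K N : ModuleCat.{u} A} (h : IsSubgenerated K N)
    (hK : IsContinuousModule κ K) : IsContinuousModule κ N := by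
  obtain ⟨Q, ⟨Λ, g, hg⟩, i, hi⟩ := h
  exact ((hK.finsupp Λ).of_surjective g hg).of_injective i hi

variable {B : Subalgebra R A}

/-- Choose `b` agreeing with `a` on the union of the two finite sets that control `m` and `n`. Two
elements at once are needed, to compare an element with its image, or two elements with the same
image. -/
lemma IsPairingDense.exists_smul_eq (hB : IsPairingDense κ B) (hM : IsContinuousModule κ M)
    (hN : IsContinuousModule κ N) (a : A) (m : M) (n : N) :
    ∃ b ∈ B, b • m = a • m ∧ b • n = a • n := by
  classical
  obtain ⟨F, hF⟩ := hM m
  obtain ⟨F', hF'⟩ := hN n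
  obtain ⟨b, hb, h⟩ := hB a (F ∪ F')
  refine ⟨b, hb, ?_, ?_⟩
  · rw [← sub_eq_zero, ← sub_smul]
    exact hF _ fun c hc => by simp [h c (Finset.mem_union_left _ hc)]
  · rw [← sub_eq_zero, ← sub_smul]
    exact hF' _ fun c hc => by simp [h c (Finset.mem_union_right _ hc)]

lemma IsPairingDense.map_smul (hB : IsPairingDense κ B) (hM : IsContinuousModule κ M)
    (hN : IsContinuousModule κ N) (f : M →+ N) (hf : ∀ b ∈ B, ∀ m, f (b • m) = b • f m)
    (a : A) (m : M) : f (a • m) = a • f m := by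
  obtain ⟨b, hb, h1, h2⟩ := hB.exists_smul_eq hM hN a m (f m)
  rw [← h1, hf b hb, h2]

/-- The image of `i` is `A`-stable, because on each of its elements `a` acts like some `b ∈ B`. -/
lemma IsPairingDense.exists_module_of_injective {N : Type u} [AddCommGroup N] [jB : Module B N]
    (hB : IsPairingDense κ B) (hM : IsContinuousModule κ M)
    (i : N →+ M) (hi : Function.Injective i) (h : ∀ (b : B) n, i (b • n) = (b : A) • i n) :
    ∃ j : Module A N, (∀ (b : B) (n : N), j.smul b n = jB.smul b n) ∧
      ∀ (a : A) n, i (j.smul a n) = a • i n := by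
  have hex : ∀ (a : A) (n : N), ∃ n', i n' = a • i n := fun a n => by
    obtain ⟨b, hb, h1, -⟩ := hB.exists_smul_eq hM hM a (i n) (i n)
    exact ⟨(⟨b, hb⟩ : B) • n, (h ⟨b, hb⟩ n).trans h1⟩
  choose s hs using hex
  exact ⟨let _ : SMul A N := ⟨s⟩; hi.module A i hs, fun b n => hi ((hs _ _).trans (h b n).symm), hs⟩

/-- The action descends: if `g m = g m'`, one `b ∈ B` acts like `a` on both `m` and `m'`, and `g` is
`B`-linear. -/
lemma IsPairingDense.exists_module_of_surjective {Q : Type u} [AddCommGroup Q] [jB : Module B Q]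
    (hB : IsPairingDense κ B) (hM : IsContinuousModule κ M)
    (g : M →+ Q) (hg : Function.Surjective g) (h : ∀ (b : B) m, g ((b : A) • m) = b • g m) :
    ∃ j : Module A Q, (∀ (b : B) (q : Q), j.smul b q = jB.smul b q) ∧
      ∀ (a : A) m, g (a • m) = j.smul a (g m) := by
  have key : ∀ (a : A) (m m' : M), g m = g m' → g (a • m) = g (a • m') := fun a m m' hm => by
    obtain ⟨b, hb, h1, h2⟩ := hB.exists_smul_eq hM hM a m m'
    rw [← h1, ← h2]
    exact (h ⟨b, hb⟩ m).trans ((congrArg _ hm).trans (h ⟨b, hb⟩ m').symm)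
  have hs : ∀ (a : A) m, g (a • m) = g (a • Function.surjInv hg (g m)) := fun a m =>
    key a _ _ (Function.surjInv_eq hg (g m)).symm
  refine ⟨let _ : SMul A Q := ⟨fun a q => g (a • Function.surjInv hg q)⟩; hg.module A g hs,
    fun b q => ?_, hs⟩
  obtain ⟨m, rfl⟩ := hg q
  exact (hs b m).symm.trans (h b m)

end

section Restriction

variable {B : Subalgebra R A} {P : ObjectProperty (ModuleCat.{u} A)}
  {P' : ObjectProperty (ModuleCat.{u} B)}

/-- Restriction of scalars to a dense subalgebra is fully faithful and injective on objects, on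
continuous modules. -/
lemma IsPairingDense.isIsoOfCategories_lift (hB : IsPairingDense κ B)
    (hP : ∀ M, P M → IsContinuousModule κ M)
    (hF : ∀ M, P' ((P.ι ⋙ ModuleCat.restrictScalars B.val.toRingHom).obj M))
    (hsurj : ∀ N, P' N → ∃ M, P M ∧ (ModuleCat.restrictScalars B.val.toRingHom).obj M = N) :
    IsIsoOfCategories (P'.lift (P.ι ⋙ ModuleCat.restrictScalars B.val.toRingHom) hF) := by
  refine ⟨⟨fun {M N} f => ?_⟩, ⟨fun {M N} f g h => ?_⟩, fun M N h => ?_, fun N => ?_⟩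
  · let f' : M.obj →+ N.obj := f.hom.hom.toAddMonoidHom
    refine ⟨ObjectProperty.homMk (ModuleCat.ofHom
      { toFun := f', map_add' := map_add f', map_smul' := fun a m =>
          hB.map_smul (hP _ M.property) (hP _ N.property) f'
            (fun b hb m => f.hom.hom.map_smul (⟨b, hb⟩ : B) m) a m }), rfl⟩
  · ext x
    exact congrArg (fun k : (P'.lift _ hF).obj M ⟶ (P'.lift _ hF).obj N => k.hom.hom x) h
  -- Equality of the restrictions makes transport of carriers `B`-linear; density upgrades it to
  -- `A`-linear, so the `A`-modules agree.
  · obtain ⟨e, f, hf⟩ := ModuleCat.exists_cast (congrArg ObjectProperty.FullSubcategory.obj h)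
    let f' : M.obj →+ N.obj := f.toAddMonoidHom
    refine ObjectProperty.FullSubcategory.ext (ModuleCat.eq_of_cast e
      { toFun := f', map_add' := map_add f', map_smul' := fun a m =>
          hB.map_smul (hP _ M.property) (hP _ N.property) f'
            (fun b hb m => f.map_smul (⟨b, hb⟩ : B) m) a m } hf)
  · obtain ⟨M, hM, h⟩ := hsurj N.obj N.property
    exact ⟨⟨M, hM⟩, ObjectProperty.FullSubcategory.ext h⟩

/-- The `A`-action is first pushed down to the quotient `Q` of `K^(Λ)`, which is again continuous,
and then restricted to `N`. -/
lemma IsPairingDense.exists_isSubgenerated (hB : IsPairingDense κ B) {K : ModuleCat.{u} A}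
    (hK : IsContinuousModule κ K) (N : ModuleCat.{u} B)
    (hN : IsSubgenerated (restrictModule B K) N) :
    ∃ M, IsSubgenerated K M ∧ (ModuleCat.restrictScalars B.val.toRingHom).obj M = N := by
  obtain ⟨Q, ⟨Λ, g, hg⟩, i, hi⟩ := hN
  let g' : (Λ →₀ K) →+ Q := g.toAddMonoidHom
  obtain ⟨jQ, h1, h2⟩ := hB.exists_module_of_surjective (hK.finsupp Λ) g' hg
    (fun b m => g.map_smul b m)
  have hQ : IsContinuousModule κ Q := (hK.finsupp Λ).of_surjective
    { toFun := g', map_add' := map_add g', map_smul' := h2 } hg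
  obtain ⟨jN, h3, h4⟩ := hB.exists_module_of_injective hQ i.toAddMonoidHom hi
    (fun b m => (i.map_smul b m).trans (h1 b _).symm)
  refine ⟨ModuleCat.of A N, ⟨ModuleCat.of A Q, ⟨Λ,
    { toFun := g', map_add' := map_add g', map_smul' := h2 }, hg⟩,
    { toFun := i, map_add' := map_add i, map_smul' := h4 }, hi⟩, ?_⟩
  exact ModuleCat.of_eq_of_smul N _ h3

lemma IsPairingDense.isIsoOfCategories_sigmaRestrict (hB : IsPairingDense κ B)
    {K : ModuleCat.{u} A} (hK : IsContinuousModule κ K) :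
    IsIsoOfCategories (sigmaRestrict K B) :=
  hB.isIsoOfCategories_lift (fun _ h => h.isContinuousModule hK) _ (hB.exists_isSubgenerated hK)

/-- If restriction `σ[_A K] → σ[_B K]` is full and surjective on objects, then every finite family
of elements of `K` is mapped by `a : A` in the same way as by some `b : B`. -/
lemma exists_smul_eq_of_isIsoOfCategories_sigmaRestrict {K : ModuleCat.{u} A}
    (h : IsIsoOfCategories (sigmaRestrict K B)) (a : A) (F : Finset K) :
    ∃ b ∈ B, ∀ c ∈ F, b • c = a • c := by
  classical
  obtain ⟨hfull, -, -, hsurj⟩ := h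
  -- Copies of `K` indexed by `K` itself let one element `x` carry every `c ∈ F` as its coordinate
  -- at `c`.
  let E : (IsSubgenerated K).FullSubcategory := ⟨ModuleCat.of A (K →₀ K),
    ModuleCat.of A (K →₀ K), ⟨K, LinearMap.id, Function.surjective_id⟩, LinearMap.id,
    Function.injective_id⟩
  let x : K →₀ K := ∑ c ∈ F, Finsupp.single c c
  have hx : ∀ c ∈ F, x c = c := fun c hc => by
    simp [x, Finsupp.finsetSum_apply, Finsupp.single_apply]; exact fun h => (h hc).elim
  let E' := (sigmaRestrict K B).obj E
  let x' : E'.obj := x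
  let S : Submodule B E'.obj := Submodule.span B {x'}
  -- The cyclic module `B x` lies in `σ[_B K]`, so it is the restriction of an `A`-module. By
  -- fullness its inclusion is `A`-linear, whence `a x ∈ B x`.
  let D : (IsSubgenerated (restrictModule B K)).FullSubcategory := ⟨ModuleCat.of B S, by
    obtain ⟨Q, hQ, i, hi⟩ := E'.property
    exact ⟨Q, hQ, i ∘ₗ S.subtype, hi.comp S.injective_subtype⟩⟩
  obtain ⟨M, hM⟩ := hsurj D
  let f : (sigmaRestrict K B).obj M ⟶ (sigmaRestrict K B).obj E :=
    eqToHom hM ≫ ObjectProperty.homMk (ModuleCat.ofHom S.subtype)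
  obtain ⟨f', hf'⟩ := hfull.map_surjective f
  have hf : ∀ m : M.obj, f'.hom.hom m = f.hom.hom m := fun m => by
    rw [← hf']; rfl
  have hmem : ∀ m : M.obj, f.hom.hom m ∈ S := fun m =>
    ((eqToHom hM).hom.hom m).2
  have hx' : ∃ m : M.obj, f.hom.hom m = x := by
    let z : S := ⟨x', Submodule.mem_span_singleton_self _⟩
    refine ⟨(eqToHom hM.symm).hom.hom z, ?_⟩
    have h1 : (eqToHom hM.symm ≫ eqToHom hM).hom.hom z = z := by simp
    exact congrArg Subtype.val h1
  obtain ⟨m, hm⟩ := hx'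
  have h1 : f'.hom.hom (a • m) = a • x := by rw [map_smul, hf m, hm]
  obtain ⟨b, hb⟩ := Submodule.mem_span_singleton.1 (hmem (a • m))
  have h2 := hb.trans ((hf (a • m)).symm.trans h1)
  refine ⟨b, b.2, fun c hc => ?_⟩
  have h3 : (b : A) • x c = a • x c := congrArg (fun y : K →₀ K => y c) h2
  rwa [hx c hc] at h3

end Restriction

end Continuous

/-! ### Rational elements and closure properties -/

section RationalElements

variable {R A C : Type u} [CommRing R] [Ring A] [Algebra R A] [AddCommGroup C] [Module R C]
  (κ : A →ₗ[R] C →ₗ[R] R)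

/-- The elements of the rational submodule of an `A`-module. -/
def IsRationalElem (M : Type u) [AddCommGroup M] [Module A M] (m : M) : Prop :=
  letI : Module R M := Module.restrictScalars R A M
  ∃ t : M ⊗[R] C, ∀ a : A, alphaMap κ M t a = a • m

lemma isRational_iff (M : ModuleCat.{u} A) :
    IsRational κ M ↔ ∀ m : M, IsRationalElem κ M m := by
  let _ : Module R M := Module.restrictScalars R A M
  have : IsScalarTower R A M := IsScalarTower.restrictScalars R A M
  have h : ∀ m : M, m ∈ rat κ M ↔ IsRationalElem κ M m := fun m =>
    exists_congr fun t => LinearMap.ext_iff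
  exact (Submodule.eq_top_iff' (p := rat κ M)).trans (forall_congr' h)

variable {κ} {M N : Type u} [AddCommGroup M] [Module A M] [AddCommGroup N] [Module A N]

/-- An `R`-structure compatible with the `A`-action is unique, so rationality may be tested with any
given one. -/
lemma IsRationalElem.of_isScalarTower [i : Module R M] [IsScalarTower R A M] {m : M} (t : M ⊗[R] C)
    (ht : ∀ a : A, alphaMap κ M t a = a • m) : IsRationalElem κ M m := by
  obtain rfl : i = Module.restrictScalars R A M := Module.ext' _ _ fun r x => by
    conv_lhs => rw [← one_smul A x, ← smul_assoc, ← Algebra.algebraMap_eq_smul_one]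
    rfl
  exact ⟨t, ht⟩

lemma IsRationalElem.zero : IsRationalElem κ M 0 := by
  let _ : Module R M := Module.restrictScalars R A M
  exact ⟨0, fun a => by rw [map_zero, LinearMap.zero_apply, smul_zero]⟩

lemma IsRationalElem.add {m n : M} (hm : IsRationalElem κ M m) (hn : IsRationalElem κ M n) :
    IsRationalElem κ M (m + n) := by
  let _ : Module R M := Module.restrictScalars R A M
  obtain ⟨s, hs⟩ := hm
  obtain ⟨t, ht⟩ := hn
  exact ⟨s + t, fun a => by rw [map_add, LinearMap.add_apply, hs, ht, smul_add]⟩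

lemma IsRationalElem.map {m : M} (hm : IsRationalElem κ M m) (g : M →ₗ[A] N) :
    IsRationalElem κ N (g m) := by
  let _ : Module R M := Module.restrictScalars R A M
  let _ : Module R N := Module.restrictScalars R A N
  have : IsScalarTower R A M := IsScalarTower.restrictScalars R A M
  have : IsScalarTower R A N := IsScalarTower.restrictScalars R A N
  obtain ⟨t, ht⟩ := hm
  refine ⟨(g.restrictScalars R).rTensor C t, fun a => ?_⟩
  rw [alphaMap_rTensor, ht, LinearMap.restrictScalars_apply, map_smul]

/-- In `(M / N) ⊗ C` the image of the representing tensor evaluates to zero, since every `a n` lies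
in `N`. By the `α`-condition it vanishes, so the tensor comes from `N ⊗ C` by right exactness. -/
lemma IsRationalElem.of_injective (hκ : AlphaCondition κ) {n : N} (g : N →ₗ[A] M)
    (hg : Function.Injective g) (hn : IsRationalElem κ M (g n)) : IsRationalElem κ N n := by
  let _ : Module R M := Module.restrictScalars R A M
  let _ : Module R N := Module.restrictScalars R A N
  have : IsScalarTower R A M := IsScalarTower.restrictScalars R A M
  have : IsScalarTower R A N := IsScalarTower.restrictScalars R A N
  let g' : N →ₗ[R] M := g.restrictScalars R
  obtain ⟨t, ht⟩ := hn
  have h0 : (LinearMap.range g').mkQ.rTensor C t = 0 := by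
    apply hκ
    ext a
    rw [alphaMap_rTensor, ht, map_zero, LinearMap.zero_apply, Submodule.mkQ_apply,
      Submodule.Quotient.mk_eq_zero]
    exact ⟨a • n, map_smul g a n⟩
  have hex : Function.Exact g' (LinearMap.range g').mkQ :=
    LinearMap.exact_iff.2 (Submodule.ker_mkQ _)
  obtain ⟨s, rfl⟩ := (rTensor_exact C hex (Submodule.mkQ_surjective _) t).1 h0
  refine ⟨s, fun a => hg ?_⟩
  have := ht a
  rw [alphaMap_rTensor] at this
  exact this.trans (map_smul g a n).symm

lemma IsRational.of_isSubgenerated (hκ : AlphaCondition κ) {K N : ModuleCat.{u} A}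
    (hK : IsRational κ K) (hN : IsSubgenerated K N) : IsRational κ N := by
  rw [isRational_iff] at hK ⊢
  obtain ⟨Q, ⟨Λ, g, hg⟩, i, hi⟩ := hN
  intro n
  refine IsRationalElem.of_injective hκ i hi ?_
  obtain ⟨x, hgx⟩ := hg (i n)
  rw [← hgx]
  refine IsRationalElem.map ?_ g
  clear hgx
  induction x using Finsupp.induction_linear with
  | zero => exact .zero
  | add x y hx hy => exact hx.add hy
  | single l c => exact (hK c).map (Finsupp.lsingle l)

/-- The finite set consists of the second components of a tensor representing `m`. -/
lemma IsRational.isContinuousModule {N : ModuleCat.{u} A} (hN : IsRational κ N) :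
    IsContinuousModule κ N := by
  classical
  intro m
  let _ : Module R N := Module.restrictScalars R A N
  obtain ⟨t, ht⟩ := (isRational_iff κ N).1 hN m
  obtain ⟨S, rfl⟩ := TensorProduct.exists_finset t
  refine ⟨S.image Prod.snd, fun a ha => ?_⟩
  rw [← ht, map_sum, LinearMap.sum_apply]
  refine Finset.sum_eq_zero fun p hp => ?_
  rw [alphaMap_tmul, ha _ (Finset.mem_image_of_mem _ hp), zero_smul]

end RationalElements

/-! ### Dual bases with forms in a prescribed set -/

section DualBasesIn

variable {R C : Type u} [CommRing R] [AddCommGroup C] [Module R C]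

/-- Dual bases on finite subsets of `C`, with coordinate forms from the set `T`. -/
def HasDualBasesIn (T : Set (DualAlg R C)) : Prop :=
  ∀ F : Finset C, ∃ (ι : Type u) (_ : Fintype ι) (f : ι → DualAlg R C) (w : ι → C),
    (∀ j, f j ∈ T) ∧ ∀ c ∈ F, c = ∑ j, (f j).ofConv c • w j

/-- The `α`-condition depends only on which forms on `C` the pairing realizes. -/
lemma alphaCondition_iff {V : Type u} [AddCommGroup V] [Module R V] {κ : V →ₗ[R] C →ₗ[R] R}
    (φ : V → DualAlg R C) (hφ : ∀ v c, κ v c = (φ v).ofConv c) :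
    AlphaCondition κ ↔ HasDualBasesIn (Set.range φ) := by
  refine ⟨fun h F => ?_, fun h => HasLocalDualBases.alphaCondition fun F => ?_⟩
  · obtain ⟨ι, _, v, w, hw⟩ := h.hasLocalDualBases F
    exact ⟨ι, _, fun j => φ (v j), w, fun j => ⟨v j, rfl⟩, by simpa only [hφ] using hw⟩
  · obtain ⟨ι, _, f, w, hf, hw⟩ := h F
    choose v hv using hf
    exact ⟨ι, _, v, w, by simpa only [hφ, hv] using hw⟩

lemma hasDualBasesIn_univ_iff :
    HasDualBasesIn (Set.univ : Set (DualAlg R C)) ↔ IsLocallyProjective R C := by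
  rw [← Set.range_eq_univ.2 (WithConv.toConv_surjective (A := C →ₗ[R] R)),
    ← alphaCondition_iff (κ := (LinearMap.id : (C →ₗ[R] R) →ₗ[R] (C →ₗ[R] R)))
      WithConv.toConv (fun _ _ => rfl)]
  exact ⟨fun h => h.hasLocalDualBases.isLocallyProjective,
    fun h => h.hasLocalDualBases.alphaCondition⟩

/-- Given a dual basis `g_j ∈ T`, `w_j` on `F`, the form `∑ f(w_j) g_j ∈ T` agrees with `f` on `F`.
Conversely, density replaces the coordinate forms by elements of `T` with the same values on `F`. -/
lemma hasDualBasesIn_iff (T : Submodule R (DualAlg R C)) :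
    HasDualBasesIn (T : Set (DualAlg R C)) ↔ IsLocallyProjective R C ∧
      ∀ (f : DualAlg R C) (F : Finset C), ∃ b ∈ T, ∀ c ∈ F, b.ofConv c = f.ofConv c := by
  rw [← hasDualBasesIn_univ_iff]
  refine ⟨fun h => ⟨fun F => ?_, fun f F => ?_⟩, fun ⟨h, h'⟩ F => ?_⟩
  · obtain ⟨ι, _, g, w, -, hw⟩ := h F
    exact ⟨ι, _, g, w, fun _ => Set.mem_univ _, hw⟩
  · obtain ⟨ι, _, g, w, hg, hw⟩ := h F
    refine ⟨∑ j, f.ofConv (w j) • g j, T.sum_mem fun j _ => T.smul_mem _ (hg j),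
      fun c hc => ?_⟩
    conv_rhs => rw [hw c hc]
    change dualPairing R C _ c = _
    simp only [map_sum, map_smul, smul_eq_mul, LinearMap.sum_apply, LinearMap.smul_apply]
    exact Finset.sum_congr rfl fun j _ => mul_comm _ _
  · obtain ⟨ι, _, g, w, -, hw⟩ := h F
    choose b hb hbF using fun j => h' (g j) F
    refine ⟨ι, inferInstance, b, w, hb, fun c hc => ?_⟩
    simp only [hbF _ c hc]
    exact hw c hc

end DualBasesIn

/-! ### Comodules as rational modules over the dual algebra -/

section Comodules

variable {R C : Type u} [CommRing R] [AddCommGroup C] [Module R C] [Coalgebra R C]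

namespace RightComod

lemma alphaMap_coact (M : RightComod R C) (m : M) (f : DualAlg R C) :
    alphaMap (dualPairing R C) M (M.coact m) f = M.dualAct f.ofConv m := by
  change _ = TensorProduct.rid R M (f.ofConv.lTensor M (M.coact m))
  generalize M.coact m = t
  induction t with
  | zero => simp
  | add s t hs ht => simp only [map_add, LinearMap.add_apply, hs, ht]
  | tmul a b => simp [dualPairing, WithConv.linearEquiv]

lemma dualAct_smul_counit (M : RightComod R C) (r : R) (m : M) :
    M.dualAct (r • Coalgebra.counit) m = r • m := by
  conv_rhs => rw [← M.dualAct_counit m]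
  simp only [dualAct, LinearMap.lTensor_smul, LinearMap.comp_smul, LinearMap.smul_comp,
    LinearMap.smul_apply]

/-- Maps between comodules which commute with the action of the dual algebra are colinear. -/
lemma exists_hom (hα : AlphaCondition (dualPairing R C)) {M N : RightComod R C} (f : M →+ N)
    (hf : ∀ (a : DualAlg R C) m, f (M.dualAct a.ofConv m) = N.dualAct a.ofConv (f m)) :
    ∃ g : M ⟶ N, ∀ m, g.toLinearMap m = f m := by
  let f' : M →ₗ[R] N :=
    { toFun := f
      map_add' := map_add f
      map_smul' := fun r m => by
        have := hf (WithConv.toConv (r • Coalgebra.counit)) m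
        simpa only [WithConv.ofConv_toConv, dualAct_smul_counit, RingHom.id_apply] using this }
  refine ⟨⟨f', ?_⟩, fun _ => rfl⟩
  ext m
  apply hα
  ext a
  rw [LinearMap.comp_apply, LinearMap.comp_apply, alphaMap_rTensor, alphaMap_coact, alphaMap_coact]
  exact (hf a m).symm

lemma eq_of_cast {M N : RightComod R C} (e : (M : Type u) = N) (f : M ⟶ N)
    (hf : ∀ x, f.toLinearMap x = cast e x) : M = N := by
  have hadd : ∀ x y, cast e (x + y) = cast e x + cast e y := fun x y => by
    simp only [← hf, map_add]
  have hsmul : ∀ (a : R) x, cast e (a • x) = a • cast e x := fun a x => by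
    simp only [← hf, map_smul]
  have hco : ∀ x, N.coact (cast e x) = f.toLinearMap.rTensor C (M.coact x) := fun x => by
    rw [← hf]
    exact DFunLike.congr_fun f.comm x
  obtain ⟨f, hcomm⟩ := f
  dsimp only at hf hco
  rcases M with @⟨M, iM, jM, cM, hM, hM'⟩
  rcases N with @⟨N, iN, jN, cN, hN, hN'⟩
  dsimp only at e f cM cN
  subst e
  obtain rfl : iM = iN := by ext x y; exact hadd x y
  obtain rfl : jM = jN := Module.ext' _ _ hsmul
  obtain rfl : f = LinearMap.id := LinearMap.ext hf
  obtain rfl : cM = cN := LinearMap.ext fun x => by simpa using (hco x).symm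
  rfl

/-- This is coassociativity with `f` applied to the last factor: the coaction is `C^*`-linear into
`M ⊗ C`. -/
lemma coact_dualAct (M : RightComod R C) (f : C →ₗ[R] R) (m : M) :
    M.coact (M.dualAct f m) = ((regular R C).dualAct f).lTensor M (M.coact m) := by
  have h1 : ∀ t : M ⊗[R] C, M.coact (TensorProduct.rid R M (f.lTensor M t)) =
      TensorProduct.rid R (M ⊗[R] C) (f.lTensor (M ⊗[R] C) (M.coact.rTensor C t)) := by
    intro t
    induction t with
    | zero => simp
    | add s t hs ht => simp only [map_add, hs, ht]
    | tmul a b => simp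
  have h2 : ∀ (n : M) (d : C ⊗[R] C), TensorProduct.rid R (M ⊗[R] C)
      (f.lTensor (M ⊗[R] C) ((TensorProduct.assoc R M C C).symm (n ⊗ₜ d))) =
      n ⊗ₜ TensorProduct.rid R C (f.lTensor C d) := by
    intro n d
    induction d with
    | zero => simp
    | add s t hs ht => simp only [tmul_add, map_add, hs, ht]
    | tmul a b => simp
  have h3 : ∀ t : M ⊗[R] C, TensorProduct.rid R (M ⊗[R] C)
      (f.lTensor (M ⊗[R] C) ((TensorProduct.assoc R M C C).symm
        ((Coalgebra.comul (R := R) (A := C)).lTensor M t))) =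
      ((regular R C).dualAct f).lTensor M t := by
    intro t
    induction t with
    | zero => simp only [map_zero]; exact (map_zero _).symm
    | add s t hs ht =>
      simp only [map_add, hs, ht]
      exact (map_add (((regular R C).dualAct f).lTensor M) s t).symm
    | tmul a b => exact h2 a _
  have h4 := DFunLike.congr_fun M.coassoc m
  rw [← h3]
  refine (h1 (M.coact m)).trans ?_
  congr 2
  exact ((LinearEquiv.symm_apply_eq _).2 h4.symm).symm

/-- The left `C^*`-module `M ⊗ C` with action on the second factor. -/
@[reducible] def tensorDualModule (M : RightComod R C) : Module (DualAlg R C) (M ⊗[R] C) where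
  smul f t := ((regular R C).dualAct f.ofConv).lTensor M t
  one_smul t := by
    change ((regular R C).dualAct Coalgebra.counit).lTensor M t = t
    have h : (regular R C).dualAct Coalgebra.counit = LinearMap.id :=
      LinearMap.ext (dualAct_counit _)
    rw [h]
    exact DFunLike.congr_fun (LinearMap.lTensor_id M C) t
  mul_smul f g t := by
    change ((regular R C).dualAct (f * g).ofConv).lTensor M t =
      ((regular R C).dualAct f.ofConv).lTensor M (((regular R C).dualAct g.ofConv).lTensor M t)
    have h : (regular R C).dualAct (f * g).ofConv =
      (regular R C).dualAct f.ofConv ∘ₗ (regular R C).dualAct g.ofConv :=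
      LinearMap.ext (dualAct_mul _ f g)
    rw [h]
    exact DFunLike.congr_fun (LinearMap.lTensor_comp M _ _) t
  smul_zero f := map_zero _
  smul_add f := map_add _
  add_smul f g t := by
    change ((regular R C).dualAct (f.ofConv + g.ofConv)).lTensor M t =
      ((regular R C).dualAct f.ofConv).lTensor M t + ((regular R C).dualAct g.ofConv).lTensor M t
    have h : (regular R C).dualAct (f.ofConv + g.ofConv) =
      (regular R C).dualAct f.ofConv + (regular R C).dualAct g.ofConv := by
      simp only [dualAct, LinearMap.lTensor_add, LinearMap.add_comp, LinearMap.comp_add]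
    rw [h]
    exact DFunLike.congr_fun (LinearMap.lTensor_add M _ _) t
  zero_smul t := by
    change ((regular R C).dualAct 0).lTensor M t = 0
    have h : (regular R C).dualAct 0 = 0 := by
      simp only [dualAct, LinearMap.lTensor_zero, LinearMap.zero_comp, LinearMap.comp_zero]
    rw [h]
    exact DFunLike.congr_fun (LinearMap.lTensor_zero M) t

/-- The coaction embeds `M` into `M ⊗ C`, with the counit as a left inverse, and `M ⊗ C` is a
quotient of copies of `C` indexed by `M`. -/
lemma isSubgenerated_toDual (M : RightComod R C) :
    IsSubgenerated (regularDual R C) ((toDual R C).obj M) := by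
  let _ : Module (DualAlg R C) (M ⊗[R] C) := M.tensorDualModule
  let g : (M →₀ C) →ₗ[R] M ⊗[R] C := Finsupp.lsum R fun m => TensorProduct.mk R M C m
  have hg : ∀ m c, g (Finsupp.single m c) = m ⊗ₜ c := fun m c => by simp [g]
  let g' : (M →₀ (regularDual R C : Type u)) →+ M ⊗[R] C := g.toAddMonoidHom
  have hg' : ∀ (f : DualAlg R C) (x : M →₀ (regularDual R C : Type u)),
      g' (f • x) = f • g' x := by
    intro f x
    induction x using Finsupp.induction_linear with
    | zero => simp
    | add x y hx hy => rw [smul_add, map_add, hx, hy, map_add, smul_add]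
    | single m c =>
      rw [Finsupp.smul_single]
      exact (hg m ((regular R C).dualAct f.ofConv c)).trans
        (congrArg (((regular R C).dualAct f.ofConv).lTensor M) (hg m c)).symm
  have hsurj : Function.Surjective g := fun t => by
    induction t with
    | zero => exact ⟨0, map_zero _⟩
    | add s t hs ht =>
      obtain ⟨x, rfl⟩ := hs
      obtain ⟨y, rfl⟩ := ht
      exact ⟨x + y, map_add _ _ _⟩
    | tmul m c => exact ⟨_, hg m c⟩
  refine ⟨ModuleCat.of _ (M ⊗[R] C), ⟨M,
    { toFun := g', map_add' := map_add g', map_smul' := hg' }, fun t => ?_⟩,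
    { toFun := M.coact, map_add' := map_add _,
      map_smul' := fun f m => M.coact_dualAct f.ofConv m }, fun m n h => ?_⟩
  · exact hsurj t
  · have h' : M.coact m = M.coact n := h
    exact (M.dualAct_counit m).symm.trans ((congrArg (fun t => TensorProduct.rid R M
      ((Coalgebra.counit (R := R) (A := C)).lTensor M t)) h').trans (M.dualAct_counit n))

section OfRational

variable {B : Type u} [Ring B] [Algebra R B] {κ : B →ₗ[R] C →ₗ[R] R} (φ : B →+* DualAlg R C)

/-- The inner evaluation consumes `c₂` and the outer one `c₁`, which explains the order `b' * b`.
With it, coassociativity can be checked by evaluation. -/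
lemma alphaMap_alphaMap_comul (hφ : ∀ b c, κ b c = (φ b).ofConv c) {N : Type u}
    [AddCommGroup N] [Module R N] (t : N ⊗[R] C) (b b' : B) :
    alphaMap κ N
      (alphaMap κ (N ⊗[R] C)
        ((TensorProduct.assoc R N C C).symm
          ((Coalgebra.comul (R := R) (A := C)).lTensor N t)) b) b' =
      alphaMap κ N t (b' * b) := by
  have h : ∀ (n : N) (d : C ⊗[R] C),
      alphaMap κ N
        (alphaMap κ (N ⊗[R] C)
          ((TensorProduct.assoc R N C C).symm (n ⊗ₜ d)) b) b' =
        LinearMap.mul' R R (TensorProduct.map (φ b').ofConv (φ b).ofConv d) • n := by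
    intro n d
    induction d with
    | zero => simp
    | add s t hs ht => simp only [tmul_add, map_add, LinearMap.add_apply, hs, ht, add_smul]
    | tmul c c' => simp [hφ, smul_smul, mul_comm]
  induction t with
  | zero => simp
  | add s t hs ht => simp only [map_add, LinearMap.add_apply, hs, ht]
  | tmul n c =>
    rw [LinearMap.lTensor_tmul, h, alphaMap_tmul, hφ, map_mul]
    rfl

/-- A rational module over an algebra with a map to `C^*` satisfying the `α`-condition is a
`C`-comodule. -/
lemma exists_restrictScalars_toDual_eq (hφ : ∀ b c, κ b c = (φ b).ofConv c)
    (hD : HasDualBasesIn (Set.range φ)) (N : ModuleCat.{u} B)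
    (hN : IsRational κ N) :
    ∃ M : RightComod R C, (ModuleCat.restrictScalars φ).obj ((toDual R C).obj M) = N := by
  let _ : Module R N := Module.restrictScalars R B N
  have : IsScalarTower R B N := IsScalarTower.restrictScalars R B N
  have hα := (alphaCondition_iff φ hφ).2 hD
  choose t ht using (isRational_iff κ N).1 hN
  -- The representing tensors are unique by the `α`-condition, so any choice of them is linear.
  let ρ : N →ₗ[R] N ⊗[R] C :=
    { toFun := t
      map_add' := fun m n => hα N <| LinearMap.ext fun b => by
        rw [map_add, LinearMap.add_apply, ht, ht, ht, smul_add]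
      map_smul' := fun r m => hα N <| LinearMap.ext fun b => by
        rw [map_smul, LinearMap.smul_apply, ht, ht, RingHom.id_apply, smul_comm] }
  have hρ : ∀ m b, alphaMap κ N (ρ m) b = b • m := ht
  let M : RightComod R C :=
    { carrier := N
      coact := ρ
      coassoc := by
        ext m
        refine (LinearEquiv.eq_symm_apply (TensorProduct.assoc R N C C)).1 ?_
        -- Evaluating twice turns both sides into `b' b m`.
        refine hα _ (LinearMap.ext fun b => hα _ (LinearMap.ext fun b' => ?_))
        simp only [LinearMap.comp_apply]
        rw [alphaMap_alphaMap_comul φ hφ, hρ, alphaMap_rTensor, hρ, hρ, mul_smul]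
      counital := by
        ext m
        have h : ∀ s : N ⊗[R] C, TensorProduct.rid R N
            ((Coalgebra.counit (R := R) (A := C)).lTensor N s) = alphaMap κ N s 1 := by
          intro s
          induction s with
          | zero => simp
          | add s t hs ht => simp only [map_add, LinearMap.add_apply, hs, ht]
          | tmul n c =>
            rw [alphaMap_tmul, hφ, map_one]
            simp only [LinearMap.lTensor_tmul, TensorProduct.rid_tmul]
            rfl
        exact (h _).trans ((hρ m 1).trans (one_smul _ _)) }
  refine ⟨M, ModuleCat.of_eq_of_smul N _ fun b m => ?_⟩
  change M.dualAct (φ b).ofConv m = b • m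
  rw [← alphaMap_coact, ← hρ]
  change alphaMap (dualPairing R C) N (ρ m) (φ b) = _
  generalize ρ m = s
  induction s with
  | zero => simp
  | add s t hs ht => simp only [map_add, LinearMap.add_apply, hs, ht]
  | tmul n c => simp [hφ, dualPairing, WithConv.linearEquiv]

end OfRational

lemma exists_toDual_eq (hα : AlphaCondition (dualPairing R C)) (N : ModuleCat.{u} (DualAlg R C))
    (hN : IsRational (dualPairing R C) N) : ∃ M : RightComod R C, (toDual R C).obj M = N :=
  exists_restrictScalars_toDual_eq (RingHom.id (DualAlg R C)) (fun _ _ => rfl)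
    ((alphaCondition_iff _ fun _ _ => rfl).1 hα) N hN

lemma isIsoOfCategories_toRat (hα : AlphaCondition (dualPairing R C)) :
    IsIsoOfCategories (toRat R C) := by
  refine ⟨⟨fun {M N} f => ?_⟩, ⟨fun {M N} f g h => ?_⟩, fun M N h => ?_, fun N => ?_⟩
  · obtain ⟨g, hg⟩ := exists_hom hα (M := M) (N := N) f.hom.hom.toAddMonoidHom
      (fun a m => f.hom.hom.map_smul a m)
    refine ⟨g, ?_⟩
    ext m
    exact hg m
  · refine Hom.ext (LinearMap.ext fun m => ?_)
    exact congrArg (fun k : (toRat R C).obj M ⟶ (toRat R C).obj N => k.hom.hom m) h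
  · obtain ⟨e, f, hf⟩ := ModuleCat.exists_cast (congrArg ObjectProperty.FullSubcategory.obj h)
    obtain ⟨g, hg⟩ := exists_hom hα (M := M) (N := N) f.toAddMonoidHom (fun a m => f.map_smul a m)
    exact eq_of_cast e g fun x => (hg x).trans (hf x)
  · obtain ⟨M, hM⟩ := exists_toDual_eq hα N.obj N.property
    exact ⟨M, ObjectProperty.FullSubcategory.ext hM⟩

end RightComod

lemma isRational_regularDual : IsRational (dualPairing R C) (regularDual R C) :=
  RightComod.isRational_toDual _

/-- Rational modules are comodules, hence subgenerated by `C`; conversely `C` is rational and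
rationality passes to `σ[C]`. -/
lemma isRational_eq_isSubgenerated (hα : AlphaCondition (dualPairing R C)) :
    IsRational (dualPairing R C) = IsSubgenerated (regularDual R C) := by
  ext N
  refine ⟨fun hN => ?_, IsRational.of_isSubgenerated hα isRational_regularDual⟩
  obtain ⟨M, rfl⟩ := RightComod.exists_toDual_eq hα N hN
  exact M.isSubgenerated_toDual

section Restriction

variable {A : Type u} [Ring A] [Algebra R A] {κ : A →ₗ[R] C →ₗ[R] R}

lemma isRational_restrictScalars_toDual (ψ : A →+* DualAlg R C)
    (hψ : ∀ a c, κ a c = (ψ a).ofConv c) (M : RightComod R C) :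
    IsRational κ ((ModuleCat.restrictScalars ψ).obj ((RightComod.toDual R C).obj M)) := by
  refine (isRational_iff _ _).2 fun m => ?_
  let j : Module A M := letI := M.dualModule; Module.compHom M ψ
  have hj : ∀ (a : A) (m : M), a • m = M.dualAct (ψ a).ofConv m := fun _ _ => rfl
  have : IsScalarTower R A M := ⟨fun r a m => by
    rw [hj, hj]
    have : (ψ (r • a)).ofConv = r • (ψ a).ofConv := by
      ext c
      rw [← hψ, map_smul, LinearMap.smul_apply, hψ, LinearMap.smul_apply]
    rw [this]
    simp only [RightComod.dualAct, LinearMap.lTensor_smul, LinearMap.comp_smul,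
      LinearMap.smul_comp, LinearMap.smul_apply]⟩
  suffices h : ∀ m : M, IsRationalElem κ M m from h m
  intro m
  refine IsRationalElem.of_isScalarTower (M.coact m) fun a => ?_
  rw [hj, ← M.alphaMap_coact]
  generalize M.coact m = t
  induction t with
  | zero => simp
  | add s t hs ht => simp only [map_add, LinearMap.add_apply, hs, ht]
  | tmul n c => simp [hψ, dualPairing, WithConv.linearEquiv]

variable {B : Subalgebra R A}

/-- The `B`-module comes from a comodule, and a comodule carries a rational action of all of `C^*`,
which is pulled back along `ψ` to `A`. -/
lemma exists_isRational_of_restrictPairing (ψ : A →+* DualAlg R C)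
    (hψ : ∀ a c, κ a c = (ψ a).ofConv c) (hD : HasDualBasesIn (ψ '' B))
    (N : ModuleCat.{u} B) (hN : IsRational (restrictPairing κ B) N) :
    ∃ M, IsRational κ M ∧ (ModuleCat.restrictScalars B.val.toRingHom).obj M = N := by
  have hD' : HasDualBasesIn (Set.range (ψ.comp B.val.toRingHom)) := by
    convert hD
    ext x
    simp
  obtain ⟨M, hM⟩ := RightComod.exists_restrictScalars_toDual_eq (κ := restrictPairing κ B)
    (ψ.comp B.val.toRingHom) (fun _ _ => hψ _ _) hD' N hN
  exact ⟨_, isRational_restrictScalars_toDual ψ hψ M, hM⟩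

lemma isRational_restrictPairing_eq_isSubgenerated (ψ : A →+* DualAlg R C)
    (hψ : ∀ a c, κ a c = (ψ a).ofConv c) (hD : HasDualBasesIn (ψ '' B)) {K : ModuleCat.{u} A}
    (hK : IsRational κ = IsSubgenerated K) :
    IsRational (restrictPairing κ B) = IsSubgenerated (restrictModule B K) := by
  have hK' : IsRational κ K := by
    rw [hK]
    exact ⟨ModuleCat.of A (PUnit →₀ K), ⟨PUnit, LinearMap.id, Function.surjective_id⟩,
      Finsupp.lsingle PUnit.unit, Finsupp.single_injective _⟩
  ext N
  constructor
  · intro hN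
    obtain ⟨M, hM, rfl⟩ := exists_isRational_of_restrictPairing ψ hψ hD N hN
    exact IsSubgenerated.restrict B K M (hK ▸ hM)
  · have hD' : HasDualBasesIn (Set.range (ψ.comp B.val.toRingHom)) := by
      convert hD
      ext x
      simp
    exact IsRational.of_isSubgenerated
      ((alphaCondition_iff (ψ.comp B.val.toRingHom) fun _ _ => hψ _ _).2 hD')
      (IsRational.restrict _ B _ hK')

lemma isIsoOfCategories_ratRestrict (ψ : A →+* DualAlg R C)
    (hψ : ∀ a c, κ a c = (ψ a).ofConv c) (hD : HasDualBasesIn (ψ '' B))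
    (hB : IsPairingDense κ B) : IsIsoOfCategories (ratRestrict κ B) :=
  hB.isIsoOfCategories_lift (fun _ h => h.isContinuousModule) _
    (exists_isRational_of_restrictPairing ψ hψ hD)

end Restriction

variable {B : Subalgebra R (DualAlg R C)}

/-- Agreement of the actions on `c ∈ C` gives agreement of the values at `c`, by applying the
counit: `ε(f ⇀ c) = f(c)`. -/
lemma isPairingDense_of_isIsoOfCategories_sigmaRestrict
    (h : IsIsoOfCategories (sigmaRestrict (regularDual R C) B)) :
    IsPairingDense (dualPairing R C) B := by
  intro a F
  obtain ⟨b, hb, hbF⟩ := exists_smul_eq_of_isIsoOfCategories_sigmaRestrict h a F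
  refine ⟨b, hb, fun c hc => ?_⟩
  have key : ∀ (f : DualAlg R C) (c : C),
      Coalgebra.counit (R := R) (A := C) ((RightComod.regular R C).dualAct f.ofConv c) = f.ofConv c := by
    intro f c
    have h1 : ∀ t : C ⊗[R] C,
        Coalgebra.counit (R := R) (TensorProduct.rid R C (f.ofConv.lTensor C t)) =
        f.ofConv (TensorProduct.lid R C ((Coalgebra.counit (R := R) (A := C)).rTensor C t)) := by
      intro t
      induction t with
      | zero => simp
      | add s t hs ht => simp only [map_add, hs, ht]
      | tmul a b => simp [mul_comm]
    refine (h1 (Coalgebra.comul c)).trans ?_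
    rw [Coalgebra.rTensor_counit_comul, TensorProduct.lid_tmul, one_smul]
  change b.ofConv c = a.ofConv c
  rw [← key b c, ← key a c]
  exact congrArg _ (hbF c hc)

end Comodules

/-! ### Separation by linear forms and the adic topology -/

lemma exists_linearMap_ne_zero_of_isCoseparator {R : Type u} [CommRing R]
    (hR : IsCoseparator (ModuleCat.of R R)) {M : Type u} [AddCommGroup M] [Module R M] {m : M}
    (hm : m ≠ 0) : ∃ h : M →ₗ[R] R, h m ≠ 0 := by
  by_contra! H
  -- If every form killed `m`, the map `R → M`, `1 ↦ m`, could not be distinguished from zero.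
  have := hR.def (ModuleCat.ofHom (LinearMap.toSpanSingleton R M m)) 0 fun h => by
    ext
    simpa using H h.hom
  apply hm
  have h1 := congrArg (fun k => k.hom (1 : R)) this
  simpa using h1

lemma t2Space_adicTopology_iff {S : Type u} [CommRing S] (I : Ideal S) :
    @T2Space S I.adicTopology ↔ ∀ x, (∀ n : ℕ, 1 ≤ n → x ∈ I ^ n) → x = 0 := by
  let := I.adicTopology
  have := I.nonarchimedean
  constructor
  · intro h x hx
    by_contra h0
    have := (I.hasBasis_nhds_zero_adic.mem_iff).1 (isOpen_compl_singleton.mem_nhds (Ne.symm h0))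
    obtain ⟨n, -, hn⟩ := this
    -- The exponent `n + 1` covers `n = 0`, since only powers with exponent at least `1` are assumed
    -- to contain `x`.
    exact hn (Ideal.pow_le_pow_right (Nat.le_succ n) (hx (n + 1) (Nat.le_add_left 1 n))) rfl
  · intro h
    apply IsTopologicalAddGroup.t2Space_of_zero_sep
    intro x hx
    by_contra! H
    exact hx (h x fun n _ => H _ (I.hasBasis_nhds_zero_adic.mem_of_mem trivial))

/-! ### The hyperalgebra: connectedness, the `α`-condition and separation -/

namespace AffineGroupScheme

variable {R : Type u} [CommRing R] (G : AffineGroupScheme R)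

lemma connected_iff : G.Connected ↔ ∀ (f : DualAlg R G.coordRing) (F : Finset G.coordRing),
    ∃ b ∈ G.hy, ∀ c ∈ F, b.ofConv c = f.ofConv c :=
  dense_finiteTopology_iff _

lemma isAlpha_iff_hasDualBasesIn :
    G.IsAlpha ↔ HasDualBasesIn (G.hy : Set (DualAlg R G.coordRing)) := by
  have := alphaCondition_iff (V := G.hy) (C := G.coordRing) (κ := G.hyPairing) Subtype.val
    (fun _ _ => rfl)
  rw [Subtype.range_coe] at this
  exact this

lemma hasDualBasesIn_hy_iff : HasDualBasesIn (G.hy : Set (DualAlg R G.coordRing)) ↔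
    G.LocallyProjective ∧ G.Connected := by
  rw [connected_iff]
  exact hasDualBasesIn_iff (Subalgebra.toSubmodule G.hy)

lemma chi_injective_iff :
    Function.Injective G.chi ↔ ∀ c, (∀ b ∈ G.hy, b.ofConv c = 0) → c = 0 := by
  rw [injective_iff_map_eq_zero]
  refine forall_congr' fun c => imp_congr_left ⟨fun h b hb => ?_, fun h => ?_⟩
  · exact DFunLike.congr_fun h ⟨b, hb⟩
  · ext b
    exact h b b.2

lemma connected_iff_chi_injective (hR : IsCoseparator (ModuleCat.of R R)) :
    G.Connected ↔ Function.Injective G.chi := by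
  rw [connected_iff, chi_injective_iff]
  constructor
  · intro h c hc
    by_contra h0
    obtain ⟨f, hf⟩ := exists_linearMap_ne_zero_of_isCoseparator hR h0
    obtain ⟨b, hb, hbF⟩ := h (WithConv.toConv f) {c}
    exact hf ((hbF c (Finset.mem_singleton_self c)).symm.trans (hc b hb))
  · intro h f F
    let e : DualAlg R G.coordRing →ₗ[R] (F → R) :=
      LinearMap.pi fun c => (dualPairing R G.coordRing).flip (c : G.coordRing)
    have he : ∀ g c, e g c = g.ofConv c := fun _ _ => rfl
    -- If `f` restricted to `F` is not in the image `D` of `hy(G)` in `R^F`, a form on `R^F / D`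
    -- detects it. Its coefficients define a combination of elements of `F` killed by `hy(G)`, hence
    -- zero, so the form kills `f` after all.
    let D := (Subalgebra.toSubmodule G.hy).map e
    suffices hf : e f ∈ D by
      obtain ⟨b, hb, hbf⟩ := hf
      exact ⟨b, hb, fun c hc => congrFun hbf ⟨c, hc⟩⟩
    by_contra hf
    obtain ⟨l, hl⟩ := exists_linearMap_ne_zero_of_isCoseparator hR
      (m := D.mkQ (e f)) (by rwa [Submodule.mkQ_apply, Ne, Submodule.Quotient.mk_eq_zero])
    classical
    let l' : (F → R) →ₗ[R] R := l ∘ₗ D.mkQ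
    have hl' : ∀ g : DualAlg R G.coordRing,
        l' (e g) = g.ofConv (∑ c : F, l' (Pi.single c 1) • (c : G.coordRing)) := by
      intro g
      rw [map_sum, LinearMap.pi_apply_eq_sum_univ l' (e g)]
      refine Finset.sum_congr rfl fun c _ => ?_
      rw [he, map_smul, smul_eq_mul, smul_eq_mul, mul_comm]
      congr 3
      ext d
      simp [Pi.single_apply, eq_comm]
    have h0 := h (∑ c : F, l' (Pi.single c 1) • (c : G.coordRing)) fun b hb => by
      rw [← hl', LinearMap.comp_apply, Submodule.mkQ_apply,
        (Submodule.Quotient.mk_eq_zero D).2 ⟨b, hb, rfl⟩, map_zero]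
    apply hl
    change l' (e f) = 0
    rw [hl', h0, map_zero]

/-- An element is killed by `hy(G)` exactly when it lies in every `ω ^ n`: outside `ω ^ n` it is
detected by a form on `H / ω ^ n`, and such a form belongs to `hy(G)`. -/
lemma chi_injective_iff_t2Space (hR : IsCoseparator (ModuleCat.of R R)) :
    Function.Injective G.chi ↔ @T2Space G.coordRing G.augIdeal.adicTopology := by
  rw [chi_injective_iff, t2Space_adicTopology_iff]
  refine forall_congr' fun c => imp_congr_left ⟨fun h n hn => ?_, fun h b ⟨n, hn, hb⟩ =>
    hb c (h n hn)⟩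
  by_contra hc
  obtain ⟨l, hl⟩ := exists_linearMap_ne_zero_of_isCoseparator hR
    (m := ((G.augIdeal ^ n).restrictScalars R).mkQ c)
    (by rwa [Submodule.mkQ_apply, Ne, Submodule.Quotient.mk_eq_zero])
  refine hl (h (WithConv.toConv (l ∘ₗ ((G.augIdeal ^ n).restrictScalars R).mkQ)) ⟨n, hn,
    fun x hx => ?_⟩)
  have h0 : ((G.augIdeal ^ n).restrictScalars R).mkQ x = 0 :=
    (Submodule.Quotient.mk_eq_zero _).2 hx
  exact (congrArg l h0).trans (map_zero l)

/-! ### The comodule of a `G`-module -/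

/-- The universal point of `G`. -/
def univPt : G.points.obj (CommAlgCat.of R G.coordRing) := G.pt (AlgHom.id R G.coordRing)

lemma map_univPt {A : Type u} [CommRing A] [Algebra R A] (φ : G.coordRing →ₐ[R] A) :
    G.points.map (CommAlgCat.ofHom φ) G.univPt = G.pt φ := by
  rw [univPt, map_pt, AlgHom.comp_id]

lemma ev_univPt : G.ev G.univPt = AlgHom.id R G.coordRing := G.ev_pt _

namespace Mod

variable {G} (X : G.Mod)

/-- The action of the universal point: `m ↦ ∑ m₁ ⊗ m₀`. -/
def univAct : X →ₗ[R] G.coordRing ⊗[R] X where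
  toFun m := X.ρ (CommAlgCat.of R G.coordRing) G.univPt (1 ⊗ₜ m)
  map_add' m n := by rw [tmul_add, map_add]
  map_smul' r m := by
    rw [tmul_smul, RingHom.id_apply, ← algebraMap_smul G.coordRing r, map_smul, algebraMap_smul]

/-- Every point is the image of the universal point, so naturality and `A`-linearity determine the
whole action. -/
lemma ρ_pt_tmul {A : Type u} [CommRing A] [Algebra R A] (φ : G.coordRing →ₐ[R] A) (a : A) (m : X) :
    X.ρ (CommAlgCat.of R A) (G.pt φ) (a ⊗ₜ m) = a • φ.toLinearMap.rTensor X (X.univAct m) := by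
  have h := X.natural (CommAlgCat.ofHom φ) G.univPt (1 ⊗ₜ m)
  rw [map_univPt] at h
  have h1 : (a ⊗ₜ[R] m : A ⊗[R] X) = a • (φ.toLinearMap.rTensor X (1 ⊗ₜ m)) := by
    simp [smul_tmul']
  rw [h1]
  refine (map_smul (X.ρ (CommAlgCat.of R A) (G.pt φ)) a _).trans ?_
  exact congrArg (a • ·) h.symm

lemma rTensor_counitHom_univAct (m : X) :
    G.counitHom.toLinearMap.rTensor X (X.univAct m) = 1 ⊗ₜ m := by
  have h := X.ρ_pt_tmul G.counitHom 1 m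
  rw [one_smul] at h
  rw [← h]
  have h1 : G.pt G.counitHom = 1 := G.pt_ev _
  rw [h1, map_one]
  rfl

/-- The comultiplication is, as a point, the product of the two universal points; multiplicativity
of the action then becomes coassociativity in `toComod`. -/
lemma rTensor_comulHom_univAct (m : X) :
    G.comulHom.toLinearMap.rTensor X (X.univAct m) =
      X.ρ (CommAlgCat.of R (G.coordRing ⊗[R] G.coordRing))
        (G.pt Algebra.TensorProduct.includeLeft)
        ((Algebra.TensorProduct.includeRight :
          G.coordRing →ₐ[R] G.coordRing ⊗[R] G.coordRing).toLinearMap.rTensor X (X.univAct m)) := by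
  have h := X.ρ_pt_tmul G.comulHom 1 m
  rw [one_smul] at h
  have h1 : G.pt G.comulHom = G.pt Algebra.TensorProduct.includeLeft *
    G.pt Algebra.TensorProduct.includeRight := G.pt_ev _
  have h2 := X.ρ_pt_tmul (Algebra.TensorProduct.includeRight :
    G.coordRing →ₐ[R] G.coordRing ⊗[R] G.coordRing) 1 m
  rw [one_smul] at h2
  rw [← h, h1, map_mul, ← h2]
  rfl

/-- The comodule with coaction given by the action of the universal point. -/
def toComod : RightComod R G.coordRing where
  carrier := X
  coact := (TensorProduct.comm R G.coordRing X).toLinearMap ∘ₗ X.univAct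
  coassoc := by
    ext m
    have h := congrArg (TensorProduct.comm R (G.coordRing ⊗[R] G.coordRing) X)
      (X.rTensor_comulHom_univAct m)
    have h1 : ∀ u : G.coordRing ⊗[R] X,
        TensorProduct.comm R (G.coordRing ⊗[R] G.coordRing) X
          (G.comulHom.toLinearMap.rTensor X u) =
        (Coalgebra.comul (R := R) (A := G.coordRing)).lTensor X
          (TensorProduct.comm R G.coordRing X u) := by
      intro u
      induction u with
      | zero => simp
      | add s t hs ht => simp only [map_add, hs, ht]
      | tmul a n => rfl
    have h2 : ∀ (u : G.coordRing ⊗[R] X) (a : G.coordRing),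
        TensorProduct.comm R (G.coordRing ⊗[R] G.coordRing) X
          ((1 ⊗ₜ a : G.coordRing ⊗[R] G.coordRing) •
            ((Algebra.TensorProduct.includeLeft :
              G.coordRing →ₐ[R] G.coordRing ⊗[R] G.coordRing).toLinearMap.rTensor X u)) =
        TensorProduct.assoc R X G.coordRing G.coordRing
          (TensorProduct.comm R G.coordRing X u ⊗ₜ a) := by
      intro u a
      induction u with
      | zero => simp
      | add s t hs ht => simp only [map_add, smul_add, hs, ht, add_tmul]
      | tmul b n => simp [smul_tmul']
    -- The right-hand factor acts as the scalar `1 ⊗ a`, which is pulled out by linearity. What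
    -- remains is the left universal point acting on `1 ⊗ n`.
    have h3 : ∀ u : G.coordRing ⊗[R] X,
        TensorProduct.comm R (G.coordRing ⊗[R] G.coordRing) X
          (X.ρ (CommAlgCat.of R (G.coordRing ⊗[R] G.coordRing))
            (G.pt Algebra.TensorProduct.includeLeft)
            ((Algebra.TensorProduct.includeRight :
              G.coordRing →ₐ[R] G.coordRing ⊗[R] G.coordRing).toLinearMap.rTensor X u)) =
        TensorProduct.assoc R X G.coordRing G.coordRing
          (((TensorProduct.comm R G.coordRing X).toLinearMap ∘ₗ X.univAct).rTensor G.coordRing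
            (TensorProduct.comm R G.coordRing X u)) := by
      intro u
      induction u with
      | zero => simp
      | add s t hs ht => simp only [map_add, hs, ht]
      | tmul a n =>
        refine Eq.trans ?_ (h2 (X.univAct n) a)
        exact congrArg _ (X.ρ_pt_tmul _ _ _)
    rw [h1, h3] at h
    exact h.symm
  counital := by
    ext m
    have h := congrArg (TensorProduct.lid R X) (X.rTensor_counitHom_univAct m)
    rw [TensorProduct.lid_tmul, one_smul] at h
    refine Eq.trans ?_ h
    change TensorProduct.rid R X ((Coalgebra.counit (R := R) (A := G.coordRing)).lTensor X
      (TensorProduct.comm R G.coordRing X (X.univAct m))) = _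
    generalize X.univAct m = u
    induction u with
    | zero => simp
    | add s t hs ht => simp only [map_add, hs, ht]
    | tmul a n => rfl

lemma comodToMod_toComod_ρ (A : CommAlgCat.{u} R) (g : G.points.obj A) (x : A ⊗[R] X) :
    (G.comodToMod.obj X.toComod).ρ A g x = X.ρ A g x := by
  obtain ⟨φ, rfl⟩ : ∃ φ : G.coordRing →ₐ[R] A, G.pt φ = g := ⟨G.ev (A := A) g, G.pt_ev (A := A) g⟩
  induction x with
  | zero => exact (map_zero _).trans (map_zero _).symm
  | add x y hx hy => exact (map_add _ _ _).trans ((congrArg₂ _ hx hy).trans (map_add _ _ _).symm)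
  | tmul a m =>
    refine Eq.trans ?_ (X.ρ_pt_tmul φ a m).symm
    change a • comodAct X.toComod (G.ev (A := A) (G.pt φ)) m = _
    rw [ev_pt]
    congr 1
    change TensorProduct.comm R X A (φ.toLinearMap.lTensor X
      (TensorProduct.comm R G.coordRing X (X.univAct m))) = _
    generalize X.univAct m = u
    induction u with
    | zero => simp
    | add s t hs ht => simp only [map_add, hs, ht]
    | tmul a n => simp

/-- A `G`-module is isomorphic to the `G`-module of its comodule. -/
def comodToModToComodIso : G.comodToMod.obj X.toComod ≅ X where
  hom :=
    { toLinearMap := (LinearMap.id : X →ₗ[R] X)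
      comm := fun A g x => by
        have h := DFunLike.congr_fun (LinearMap.lTensor_id (R := R) A X)
        exact (h _).trans ((X.comodToMod_toComod_ρ A g x).trans (congrArg _ (h x).symm)) }
  inv :=
    { toLinearMap := (LinearMap.id : X →ₗ[R] X)
      comm := fun A g x => by
        have h := DFunLike.congr_fun (LinearMap.lTensor_id (R := R) A X)
        exact (h _).trans ((X.comodToMod_toComod_ρ A g x).symm.trans (congrArg _ (h x).symm)) }
  hom_inv_id := rfl
  inv_hom_id := rfl

end Mod

/-- The coaction is recovered from the action of the universal point; fullness of `comodToMod`
follows by applying `G`-linearity to that point. -/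
lemma comodToMod_ρ_univPt (M : RightComod R G.coordRing) (m : M) :
    (G.comodToMod.obj M).ρ (CommAlgCat.of R G.coordRing) G.univPt (1 ⊗ₜ m) =
      TensorProduct.comm R M G.coordRing (M.coact m) := by
  change (1 : G.coordRing) • comodAct M (G.ev G.univPt) m = _
  rw [ev_univPt, one_smul]
  change TensorProduct.comm R M G.coordRing
    ((LinearMap.id : G.coordRing →ₗ[R] G.coordRing).lTensor M (M.coact m)) = _
  rw [LinearMap.lTensor_id]
  rfl

instance : G.comodToMod.Faithful where
  map_injective h := RightComod.Hom.ext (congrArg Mod.Hom.toLinearMap h)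

instance : G.comodToMod.Full where
  map_surjective {M N} f := by
    refine ⟨⟨f.toLinearMap, ?_⟩, rfl⟩
    ext m
    have h := f.comm (CommAlgCat.of R G.coordRing) G.univPt (1 ⊗ₜ m)
    have h' := (congrArg (f.toLinearMap.lTensor G.coordRing)
      (G.comodToMod_ρ_univPt M m)).symm.trans (h.trans (G.comodToMod_ρ_univPt N (f.toLinearMap m)))
    apply (TensorProduct.comm R N G.coordRing).injective
    have key : ∀ (k : M →ₗ[R] N) (t : M ⊗[R] G.coordRing),
        k.lTensor G.coordRing (TensorProduct.comm R M G.coordRing t) =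
          TensorProduct.comm R N G.coordRing (k.rTensor G.coordRing t) := by
      intro k t
      induction t with
      | zero => simp
      | add s t hs ht => simp only [map_add, hs, ht]
      | tmul a n => rfl
    exact h'.symm.trans (key f.toLinearMap (M.coact m))

instance : G.comodToMod.EssSurj where
  mem_essImage X := ⟨X.toComod, ⟨X.comodToModToComodIso⟩⟩

instance : G.comodToMod.IsEquivalence where

end AffineGroupScheme

end

theorem mainTheorem8 {R : Type u} [CommRing R] (G : AffineGroupScheme R) :
    -- (1) the locally projective case
    (G.LocallyProjective →
      G.comodToMod.IsEquivalence ∧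
      IsIsoOfCategories (RightComod.toRat R G.coordRing) ∧
      IsRational (dualPairing R G.coordRing) = IsSubgenerated (regularDual R G.coordRing)) ∧
    -- (2) the `α`-condition
    (G.IsAlpha ↔ G.LocallyProjective ∧ G.Connected) ∧
    (G.LocallyProjective ∧ G.Connected →
      G.comodToMod.IsEquivalence ∧
      IsIsoOfCategories (RightComod.toRat R G.coordRing) ∧
      IsRational (dualPairing R G.coordRing) = IsSubgenerated (regularDual R G.coordRing) ∧
      IsIsoOfCategories (ratRestrict (dualPairing R G.coordRing) G.hy) ∧
      IsRational (restrictPairing (dualPairing R G.coordRing) G.hy) =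
        IsSubgenerated (restrictModule G.hy (regularDual R G.coordRing))) ∧
    -- (3) connectedness
    (G.Connected ↔ IsIsoOfCategories (sigmaRestrict (regularDual R G.coordRing) G.hy)) ∧
    (Injective (ModuleCat.of R R) → IsCoseparator (ModuleCat.of R R) →
      (G.Connected ↔ Function.Injective G.chi) ∧
      (G.Connected ↔ @T2Space G.coordRing G.augIdeal.adicTopology)) := by

  have hα : G.LocallyProjective → AlphaCondition (dualPairing R G.coordRing) := fun h =>
    (alphaCondition_iff id fun _ _ => rfl).2
      (by rw [Set.range_id]; exact hasDualBasesIn_univ_iff.2 h)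
  have hdense : G.Connected ↔ IsPairingDense (dualPairing R G.coordRing) G.hy := G.connected_iff
  have h1 : G.LocallyProjective →
      G.comodToMod.IsEquivalence ∧
      IsIsoOfCategories (RightComod.toRat R G.coordRing) ∧
      IsRational (dualPairing R G.coordRing) = IsSubgenerated (regularDual R G.coordRing) :=
    fun h => ⟨inferInstance, RightComod.isIsoOfCategories_toRat (hα h),
      isRational_eq_isSubgenerated (hα h)⟩
  refine ⟨h1, G.isAlpha_iff_hasDualBasesIn.trans G.hasDualBasesIn_hy_iff, fun h => ?_,
    ⟨fun h => ?_, fun h => ?_⟩, fun _ hR => ⟨G.connected_iff_chi_injective hR,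
      (G.connected_iff_chi_injective hR).trans (G.chi_injective_iff_t2Space hR)⟩⟩
  · obtain ⟨e1, e2, e3⟩ := h1 h.1
    have hD : HasDualBasesIn (RingHom.id (DualAlg R G.coordRing) '' G.hy) := by
      have := G.hasDualBasesIn_hy_iff.2 h
      rwa [RingHom.coe_id, Set.image_id]
    exact ⟨e1, e2, e3,
      isIsoOfCategories_ratRestrict (RingHom.id _) (fun _ _ => rfl) hD (hdense.1 h.2),
      isRational_restrictPairing_eq_isSubgenerated (RingHom.id _) (fun _ _ => rfl) hD e3⟩
  · exact (hdense.1 h).isIsoOfCategories_sigmaRestrict isRational_regularDual.isContinuousModule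
  · exact hdense.2 (isPairingDense_of_isIsoOfCategories_sigmaRestrict h)
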